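/- Let $W$ be a standard Brownian motion on a probability space, and let $T,S_0,I_0,v_0>0$, $\lambda\in(0,1)$ and $\bar\sigma\in\mathbb R$ be constants. Let $r,\rho,\sigma\in L^\infty(0,T)$ be deterministic functions with $0<\sigma_*<\sigma(t)<\sigma^*<\infty$ for almost every $t\in(0,T)$, where $\sigma_*,\sigma^*$ are constants. Let $S$ be the solution of $dS_t=\rho(t)S_t\,dt+\sigma(t)S_t\,dW_t$ started at $S_0$, that is, $$S_t=S_0\exp\Big(\int_0^t\big(\rho(s)-\tfrac12\sigma(s)^2\big)ds+\int_0^t\sigma(s)\,dW_s\Big).$$ For $N\ge1$ put $\Delta t=T/N$, $t_n=n\Delta t$, $v_0^{(N)}=u_0^{(N)}=v_0$ and, for $1\le n\le N$, $$v_n^{(N)}=\lambda v_{n-1}^{(N)}+\frac{1-\lambda}{\Delta t}\Big(\frac{S_{t_n}}{S_{t_{n-1}}}-1\Big)^2,\qquad u_n^{(N)}=\lambda u_{n-1}^{(N)}+\frac{1-\lambda}{\Delta t}\Big(\int_{t_{n-1}}^{t_n}\sigma(t)\,dW_t\Big)^2 .$$ Let $I^{(N)}$ be the index with $I^{(N)}_0=I_0$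 and $$\frac{dI_t^{(N)}}{I_t^{(N)}}=\big(1-w_{n-1}\big)r(t)\,dt+w_{n-1}\frac{dS_t}{S_t},\quad t\in[t_{n-1},t_n),\qquad w_{n-1}=\frac{\bar\sigma}{\sqrt{v_{n-1}^{(N)}}},$$ that is, $I^{(N)}_{t_n}=I^{(N)}_{t_{n-1}}\exp\big(\int_{t_{n-1}}^{t_n}[(1-w_{n-1})r+w_{n-1}\rho-\tfrac12w_{n-1}^2\sigma^2]\,dt+w_{n-1}\int_{t_{n-1}}^{t_n}\sigma\,dW_t\big)$, and let $X^{(N)}$ be defined in the same way, with $X_0^{(N)}=I_0$ and with $u_{n-1}^{(N)}$ in place of $v_{n-1}^{(N)}$. Then, as $N\to\infty$: (i) $\log I_T^{(N)}-\log X_T^{(N)}$ converges in distribution to $0$; (ii) the random variable $$\sum_{k=1}^N\Big(\frac{\bar\sigma}{\sqrt{v_{k-1}^{(N)}}}-\frac{\bar\sigma}{\sqrt{u_{k-1}^{(N)}}}\Big)\int_{t_{k-1}}^{t_k}[\rho(t)-r(t)]\,dt+\frac12\sum_{k=1}^N\Big(\frac{\bar\sigma^2}{v_{k-1}^{(N)}}-\frac{\bar\sigma^2}{u_{k-1}^{(N)}}\Big)\int_{t_{k-1}}^{t_k}\sigma(t)^2\,dt+\sum_{k=1}^N\Big(\frac{\bar\sigma}{\sqrt{v_{k-1}^{(N)}}}-\frac{\bar\sigma}{\sqrt{u_{k-1}^{(N)}}}\Big)\int_{t_{k-1}}^{t_k}\sigma(t)\,dW_t$$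 converges in distribution to $0$; (iii) $I_T^{(N)}$ converges in distribution if and only if $X_T^{(N)}$ converges in distribution; more precisely, for every probability law $\nu$ on $\mathbb R$, $I_T^{(N)}$ converges in distribution to $\nu$ if and only if $X_T^{(N)}$ does. -/

import Mathlib

open MeasureTheory ProbabilityTheory Filter
open scoped NNReal ENNReal Topology

noncomputable section

namespace VolTarget

variable {Ω : Type*} [MeasurableSpace Ω]

/-! ### The Wiener integral of a deterministic square integrable function -/

/-- The step function `∑ₜ c t • 𝟙_{(0, t]}` on `ℝ`, where `c` is a finitely supported family of
coefficients. Since `𝟙_{(a, b]} = 𝟙_{(0, b]} - 𝟙_{(0, a]}`, these are exactly the finite linear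
combinations of indicators of intervals `(a, b]` with `0 ≤ a ≤ b`. -/
def stepFun (c : ℝ≥0 →₀ ℝ) (x : ℝ) : ℝ :=
  c.sum fun t y ↦ (Set.Ioc (0 : ℝ) (t : ℝ)).indicator (fun _ ↦ y) x

/-- The integral of `stepFun c` against the process `W`: the linear map which sends
`𝟙_{(0, t]}` to `W t - W 0`, hence `𝟙_{(a, b]}` to `W b - W a`. -/
def stepIntegral (W : ℝ≥0 → Ω → ℝ) (c : ℝ≥0 →₀ ℝ) (ω : Ω) : ℝ :=
  c.sum fun t y ↦ y * (W t ω - W 0 ω)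

/-- `Y` is (a version of) the Wiener integral `∫ f dW`: it is the `L²(P)`-limit of the integrals
of some sequence of step functions which converges to `f` in `L²(ℝ)`. -/
structure IsWienerIntegral (W : ℝ≥0 → Ω → ℝ) (P : Measure Ω) (f : ℝ → ℝ) (Y : Ω → ℝ) : Prop where
  memLp : MemLp Y 2 P
  approx : ∃ φ : ℕ → (ℝ≥0 →₀ ℝ),
    Tendsto (fun n ↦ eLpNorm (fun x ↦ stepFun (φ n) x - f x) 2 (volume : Measure ℝ))
      atTop (𝓝 0) ∧
    Tendsto (fun n ↦ eLpNorm (fun ω ↦ stepIntegral W (φ n) ω - Y ω) 2 P) atTop (𝓝 0)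

open Classical in
/-- The Wiener integral `∫_a^b f(t) dW_t` for `0 ≤ a ≤ b`, a random variable which is determined
up to a `P`-null set (when `W` is a Brownian motion and `f` is square integrable on `(a, b]`). -/
def wienerIntegral (W : ℝ≥0 → Ω → ℝ) (P : Measure Ω) (f : ℝ → ℝ) (a b : ℝ) : Ω → ℝ :=
  if h : ∃ Y, IsWienerIntegral W P ((Set.Ioc a b).indicator f) Y then h.choose else 0

/-! ### The risky asset and the volatility target indices -/

/-- The constants and deterministic coefficient functions of the model. -/
structure Model where
  /-- the time horizon -/
  T : ℝ
  /-- the initial price of the risky asset -/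
  S₀ : ℝ
  /-- the initial value of the index -/
  I₀ : ℝ
  /-- the initial realised variance -/
  v₀ : ℝ
  /-- the weight of the exponential moving average -/
  lam : ℝ
  /-- the target volatility -/
  sbar : ℝ
  /-- the risk free rate -/
  r : ℝ → ℝ
  /-- the drift of the risky asset -/
  ρ : ℝ → ℝ
  /-- the volatility of the risky asset -/
  σ : ℝ → ℝ

namespace Model

/-- The observation window `Δt = T / N`. -/
def dt (M : Model) (N : ℕ) : ℝ := M.T / N

/-- The observation times `tₙ = n Δt`. -/
def time (M : Model) (N n : ℕ) : ℝ := n * M.dt N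

/-- The risky asset, that is the solution
`S_t = S₀ exp (∫₀ᵗ (ρ - σ² / 2) ds + ∫₀ᵗ σ dW)` of `dS = ρ S dt + σ S dW`. -/
def S (M : Model) (W : ℝ≥0 → Ω → ℝ) (P : Measure Ω) (t : ℝ) (ω : Ω) : ℝ :=
  M.S₀ * Real.exp ((∫ s in (0 : ℝ)..t, (M.ρ s - M.σ s ^ 2 / 2)) + wienerIntegral W P M.σ 0 t ω)

/-- The realised annual variance `vₙ`, computed from the returns of the risky asset. -/
def v (M : Model) (W : ℝ≥0 → Ω → ℝ) (P : Measure Ω) (N : ℕ) : ℕ → Ω → ℝ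
  | 0, _ => M.v₀
  | n + 1, ω => M.lam * v M W P N n ω + (1 - M.lam) / M.dt N *
      (M.S W P (M.time N (n + 1)) ω / M.S W P (M.time N n) ω - 1) ^ 2

/-- The simplified realised variance `uₙ`, computed from the Wiener increments `∫ σ dW`. -/
def u (M : Model) (W : ℝ≥0 → Ω → ℝ) (P : Measure Ω) (N : ℕ) : ℕ → Ω → ℝ
  | 0, _ => M.v₀
  | n + 1, ω => M.lam * u M W P N n ω + (1 - M.lam) / M.dt N *
      (wienerIntegral W P M.σ (M.time N n) (M.time N (n + 1)) ω) ^ 2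

/-- The leverage `σ̄ / √q` for the realised variance `q`. -/
def leverage (M : Model) (q : ℝ) : ℝ := M.sbar / √q

/-- The value at time `tₙ` of the index with realised variance process `q`. On `[tₙ, tₙ₊₁)` the
index solves `dJ / J = (1 - w) r dt + w dS / S`, where the leverage `w = σ̄ / √qₙ` is known at time
`tₙ`; as `dS / S = ρ dt + σ dW`, the solution satisfies
`J_{tₙ₊₁} = J_{tₙ} exp (∫ ((1 - w) r + w ρ - w² σ² / 2) dt + w ∫ σ dW)`
with integrals over `[tₙ, tₙ₊₁]`. -/
def index (M : Model) (W : ℝ≥0 → Ω → ℝ) (P : Measure Ω) (N : ℕ) (q : ℕ → Ω → ℝ) : ℕ → Ω → ℝ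
  | 0, _ => M.I₀
  | n + 1, ω => index M W P N q n ω * Real.exp
      ((∫ t in (M.time N n)..(M.time N (n + 1)),
          ((1 - M.leverage (q n ω)) * M.r t + M.leverage (q n ω) * M.ρ t
            - M.leverage (q n ω) ^ 2 * M.σ t ^ 2 / 2))
        + M.leverage (q n ω) * wienerIntegral W P M.σ (M.time N n) (M.time N (n + 1)) ω)

/-- The terminal value `I_T^{(N)}` of the volatility target index (recall `T = t_N`). -/
def I (M : Model) (W : ℝ≥0 → Ω → ℝ) (P : Measure Ω) (N : ℕ) : Ω → ℝ :=
  M.index W P N (M.v W P N) N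

/-- The terminal value `X_T^{(N)}` of the simplified index. -/
def X (M : Model) (W : ℝ≥0 → Ω → ℝ) (P : Measure Ω) (N : ℕ) : Ω → ℝ :=
  M.index W P N (M.u W P N) N

/-- The sum of the drift, variance and martingale differences of the two indices. -/
def remainder (M : Model) (W : ℝ≥0 → Ω → ℝ) (P : Measure Ω) (N : ℕ) (ω : Ω) : ℝ :=
  (∑ k ∈ Finset.range N, (M.sbar / √(M.v W P N k ω) - M.sbar / √(M.u W P N k ω)) *
      ∫ t in (M.time N k)..(M.time N (k + 1)), (M.ρ t - M.r t))
    + 1 / 2 * (∑ k ∈ Finset.range N, (M.sbar ^ 2 / M.v W P N k ω - M.sbar ^ 2 / M.u W P N k ω) *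
      ∫ t in (M.time N k)..(M.time N (k + 1)), M.σ t ^ 2)
    + ∑ k ∈ Finset.range N, (M.sbar / √(M.v W P N k ω) - M.sbar / √(M.u W P N k ω)) *
      wienerIntegral W P M.σ (M.time N k) (M.time N (k + 1)) ω

end Model

/-- The random variables `Y N` converge in distribution, as `N → ∞`, to the law `ν`. -/
def TendstoLaw (P : Measure Ω) [IsProbabilityMeasure P] (Y : ℕ → Ω → ℝ)
    (ν : ProbabilityMeasure ℝ) : Prop :=
  TendstoInDistribution Y atTop (fun x : ℝ ↦ x) (fun _ ↦ P) (ν : Measure ℝ)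

end VolTarget

end

/-! The two indices are driven by the same Wiener increments `ξ k = ∫ σ dW` and differ only through
their leverages, so everything reduces to showing that `1/√v - 1/√u` and `1/v - 1/u` are small
uniformly over the windows. The function `1/√q` is singular at `0`, so `u` must be kept away from
`0`, at a rate, with probability tending to one.

All scales are powers of `g = Δt^(1/40)`, so that `Δt = g^40` and the number of windows is `T /
g^40`. The increments are independent centred Gaussians of standard deviation of order `g^20`. Two
bad events are discarded in each window. The event `|ξ k| > g^16` has probability of order `g^80`,
by Markov's inequality for the 20th moment. The event `u k < g^2` forces the last 80 increments to
be below a multiple of `g^21`, which has probability of order `g` for each of them, hence of order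
`g^80` by independence. A union bound over the windows leaves probability of order `g^40`.

Off the bad events, a return and its Gaussian increment have squares differing by order `g^48 = g^8
Δt`. The moving average does not accumulate such errors, so `|v - u|` is of order `g^8`, while `u`
and `v` are at least of order `g^2`. The inverse square roots then differ by order `g^5` and the
inverses by order `g^4` (`exists_good_event`).

The drift and variance sums are therefore of order `g^5` and `g^4`. The stochastic sum has too many
terms for absolute values, but its weights depend only on past increments: after clipping it is a
martingale transform with second moment of order `g^10` (`martingaleTransform_sq_le`). Hence all
three sums tend to `0` in probability (`tendstoInMeasure_sums`), and Slutsky's theorem transfers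
limit laws between the indices.

The Gaussian law and the independence of the increments come from the `L²` construction of the
Wiener integral: isometry, density of step functions, and characteristic functions. -/

namespace VolTarget

variable {Ω : Type*} {W : ℝ≥0 → Ω → ℝ}

/-! ### Step functions and their integrals -/

lemma stepFun_eq_sum (c : ℝ≥0 →₀ ℝ) (x : ℝ) :
    stepFun c x = ∑ t ∈ c.support, c t * (Set.Ioc (0 : ℝ) t).indicator 1 x := by
  unfold stepFun Finsupp.sum
  refine Finset.sum_congr rfl fun t _ ↦ ?_
  by_cases h : x ∈ Set.Ioc (0 : ℝ) t <;> simp [h]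

lemma stepIntegral_eq_sum (c : ℝ≥0 →₀ ℝ) (ω : Ω) :
    stepIntegral W c ω = ∑ t ∈ c.support, c t * (W t ω - W 0 ω) := rfl

lemma stepFun_add (c d : ℝ≥0 →₀ ℝ) : stepFun (c + d) = stepFun c + stepFun d := by
  ext x
  exact Finsupp.sum_add_index' (by simp) fun t a b ↦ by simp [Set.indicator_add]

lemma stepFun_smul (a : ℝ) (c : ℝ≥0 →₀ ℝ) : stepFun (a • c) = a • stepFun c := by
  ext x
  unfold stepFun
  rw [Finsupp.sum_smul_index' (by simp), Pi.smul_apply, Finsupp.smul_sum]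
  refine Finset.sum_congr rfl fun t _ ↦ ?_
  by_cases h : x ∈ Set.Ioc (0 : ℝ) t <;> simp [h]

lemma stepIntegral_add (c d : ℝ≥0 →₀ ℝ) :
    stepIntegral W (c + d) = stepIntegral W c + stepIntegral W d := by
  ext ω
  exact Finsupp.sum_add_index' (by simp) fun t a b ↦ by ring

lemma stepIntegral_smul (a : ℝ) (c : ℝ≥0 →₀ ℝ) :
    stepIntegral W (a • c) = a • stepIntegral W c := by
  ext ω
  unfold stepIntegral
  rw [Finsupp.sum_smul_index' (by simp), Pi.smul_apply, Finsupp.smul_sum]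
  exact Finset.sum_congr rfl fun t _ ↦ by simp [mul_assoc]

lemma memLp_indicator_Ioc_one (t : ℝ≥0) :
    MemLp ((Set.Ioc (0 : ℝ) t).indicator (1 : ℝ → ℝ)) 2 volume :=
  memLp_indicator_const 2 measurableSet_Ioc 1 (by simp)

lemma memLp_stepFun (c : ℝ≥0 →₀ ℝ) : MemLp (stepFun c) 2 volume := by
  have : stepFun c = fun x ↦ ∑ t ∈ c.support, c t * (Set.Ioc (0 : ℝ) t).indicator 1 x :=
    funext (stepFun_eq_sum c)
  rw [this]
  exact memLp_finsetSum _ fun t _ ↦ (memLp_indicator_Ioc_one t).const_mul _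

variable [MeasurableSpace Ω] {P : Measure Ω}

lemma isGaussianProcess_sub_zero (hW : IsPreBrownianReal W P) :
    IsGaussianProcess (fun t ω ↦ W t ω - W 0 ω) P := by
  simpa using hW.isGaussianProcess.shift 0

lemma hasGaussianLaw_stepIntegral (hW : IsPreBrownianReal W P) (c : ℝ≥0 →₀ ℝ) :
    HasGaussianLaw (stepIntegral W c) P :=
  ((isGaussianProcess_sub_zero hW).smul c).hasGaussianLaw_fun_sum (I := c.support)

lemma memLp_stepIntegral (hW : IsPreBrownianReal W P) (c : ℝ≥0 →₀ ℝ) :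
    MemLp (stepIntegral W c) 2 P :=
  (hasGaussianLaw_stepIntegral hW c).memLp_two

lemma memLp_sub_zero (hW : IsPreBrownianReal W P) (t : ℝ≥0) :
    MemLp (fun ω ↦ W t ω - W 0 ω) 2 P :=
  ((isGaussianProcess_sub_zero hW).hasGaussianLaw_eval t).memLp_two

lemma integral_sub_zero_eq_zero (hW : IsPreBrownianReal W P) (t : ℝ≥0) :
    ∫ ω, (W t ω - W 0 ω) ∂P = 0 := by
  rw [integral_sub (hW.integrable_eval t) (hW.integrable_eval 0), hW.integral_eval,
    hW.integral_eval, sub_zero]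

lemma integral_stepIntegral_eq_zero (hW : IsPreBrownianReal W P) (c : ℝ≥0 →₀ ℝ) :
    ∫ ω, stepIntegral W c ω ∂P = 0 := by
  have := hW.isGaussianProcess.isProbabilityMeasure
  simp_rw [stepIntegral_eq_sum]
  rw [integral_finsetSum]
  · exact Finset.sum_eq_zero fun t _ ↦ by
      rw [integral_const_mul, integral_sub_zero_eq_zero hW, mul_zero]
  · exact fun t _ ↦ ((memLp_sub_zero hW t).integrable (by norm_num)).const_mul _

lemma integral_sub_zero_mul_sub_zero (hW : IsPreBrownianReal W P) (s t : ℝ≥0) :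
    ∫ ω, (W s ω - W 0 ω) * (W t ω - W 0 ω) ∂P = min s t := by
  have := hW.isGaussianProcess.isProbabilityMeasure
  have h := (hW.shift 0).covariance_fun_eval s t
  simp only [zero_add] at h
  rw [covariance_eq_sub (memLp_sub_zero hW s) (memLp_sub_zero hW t),
    integral_sub_zero_eq_zero hW, zero_mul, sub_zero] at h
  exact h

lemma integral_indicator_Ioc_mul (s t : ℝ≥0) :
    ∫ x : ℝ, (Set.Ioc (0 : ℝ) s).indicator 1 x * (Set.Ioc (0 : ℝ) t).indicator 1 x
      = (min s t : ℝ) := by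
  have : ∀ x : ℝ, (Set.Ioc (0 : ℝ) s).indicator (1 : ℝ → ℝ) x *
      (Set.Ioc (0 : ℝ) t).indicator 1 x = (Set.Ioc (0 : ℝ) (min s t : ℝ)).indicator 1 x := by
    intro x
    rw [← Set.inter_indicator_mul, Set.Ioc_inter_Ioc]
    simp [Pi.one_def]
  simp_rw [this]
  rw [integral_indicator_one measurableSet_Ioc]
  simp

/-- The Itô isometry for step functions. -/
lemma integral_stepIntegral_sq (hW : IsPreBrownianReal W P) (c : ℝ≥0 →₀ ℝ) :
    ∫ ω, stepIntegral W c ω ^ 2 ∂P = ∫ x, stepFun c x ^ 2 := by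
  have := hW.isGaussianProcess.isProbabilityMeasure
  simp_rw [stepIntegral_eq_sum, stepFun_eq_sum, sq, Finset.sum_mul_sum]
  rw [integral_finsetSum, integral_finsetSum]
  · refine Finset.sum_congr rfl fun s _ ↦ ?_
    rw [integral_finsetSum, integral_finsetSum]
    · refine Finset.sum_congr rfl fun t _ ↦ ?_
      simp_rw [mul_mul_mul_comm (c s) _ (c t) _]
      rw [integral_const_mul, integral_const_mul, integral_sub_zero_mul_sub_zero hW,
        integral_indicator_Ioc_mul]
      simp
    · exact fun t _ ↦ ((memLp_indicator_Ioc_one s).const_mul _).integrable_mul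
        ((memLp_indicator_Ioc_one t).const_mul _)
    · exact fun t _ ↦ ((memLp_sub_zero hW s).const_mul _).integrable_mul
        ((memLp_sub_zero hW t).const_mul _)
  · exact fun s _ ↦ integrable_finsetSum _ fun t _ ↦
      ((memLp_indicator_Ioc_one s).const_mul _).integrable_mul
        ((memLp_indicator_Ioc_one t).const_mul _)
  · exact fun s _ ↦ integrable_finsetSum _ fun t _ ↦
      ((memLp_sub_zero hW s).const_mul _).integrable_mul ((memLp_sub_zero hW t).const_mul _)

lemma norm_toLp_sq {α : Type*} [MeasurableSpace α] {μ : Measure α} {f : α → ℝ}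
    (hf : MemLp f 2 μ) : ‖hf.toLp f‖ ^ 2 = ∫ x, f x ^ 2 ∂μ := by
  rw [← real_inner_self_eq_norm_sq, L2.inner_def]
  refine integral_congr_ae ?_
  filter_upwards [hf.coeFn_toLp] with x hx
  simp [hx, sq]

/-- `stepFun` as a linear map into `L²(ℝ)`. -/
noncomputable def stepFunLp : (ℝ≥0 →₀ ℝ) →ₗ[ℝ] Lp ℝ 2 (volume : Measure ℝ) where
  toFun c := (memLp_stepFun c).toLp _
  map_add' c d := by
    rw [← MemLp.toLp_add]
    simp_rw [stepFun_add]
  map_smul' a c := by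
    rw [RingHom.id_apply, ← MemLp.toLp_const_smul]
    simp_rw [stepFun_smul]

/-- `stepIntegral` as a linear map into `L²(P)`. -/
noncomputable def stepIntegralLp (hW : IsPreBrownianReal W P) : (ℝ≥0 →₀ ℝ) →ₗ[ℝ] Lp ℝ 2 P where
  toFun c := (memLp_stepIntegral hW c).toLp _
  map_add' c d := by
    rw [← MemLp.toLp_add]
    simp_rw [stepIntegral_add]
  map_smul' a c := by
    rw [RingHom.id_apply, ← MemLp.toLp_const_smul]
    simp_rw [stepIntegral_smul]

lemma norm_stepIntegralLp (hW : IsPreBrownianReal W P) (c : ℝ≥0 →₀ ℝ) :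
    ‖stepIntegralLp hW c‖ = ‖stepFunLp c‖ := by
  have h : ‖stepIntegralLp hW c‖ ^ 2 = ‖stepFunLp c‖ ^ 2 :=
    (norm_toLp_sq (memLp_stepIntegral hW c)).trans
      ((integral_stepIntegral_sq hW c).trans (norm_toLp_sq (memLp_stepFun c)).symm)
  exact (pow_left_inj₀ (norm_nonneg _) (norm_nonneg _) two_ne_zero).1 h

lemma map_stepIntegral (hW : IsPreBrownianReal W P) (c : ℝ≥0 →₀ ℝ) :
    P.map (stepIntegral W c) = gaussianReal 0 (‖stepFunLp c‖ ^ 2).toNNReal := by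
  have h := hasGaussianLaw_stepIntegral hW c
  rw [h.map_eq_gaussianReal, integral_stepIntegral_eq_zero hW,
    variance_of_integral_eq_zero h.aemeasurable (integral_stepIntegral_eq_zero hW c),
    integral_stepIntegral_sq hW, ← norm_toLp_sq (memLp_stepFun c)]
  rfl

/-! ### Density of the step functions -/

/-- Lebesgue differentiation: the primitive of `g` is constant near every `x > 0`, and its
derivative is `g x` for almost every `x`. -/
lemma ae_eq_zero_of_integral_Ioc_eq_zero {g : ℝ → ℝ} (hg : LocallyIntegrable g volume)
    (h : ∀ t : ℝ≥0, ∫ x in Set.Ioc (0 : ℝ) t, g x = 0) : ∀ᵐ x, 0 < x → g x = 0 := by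
  filter_upwards [LocallyIntegrable.ae_hasDerivAt_integral hg] with x hx hx0
  refine (hx 0).unique ((hasDerivAt_const x (0 : ℝ)).congr_of_eventuallyEq ?_)
  filter_upwards [lt_mem_nhds hx0] with y hy
  rw [intervalIntegral.integral_of_le hy.le]
  exact h ⟨y, hy.le⟩

lemma stepFun_single (t : ℝ≥0) :
    stepFun (Finsupp.single t 1) = (Set.Ioc (0 : ℝ) t).indicator 1 := by
  ext x
  simp [stepFun, Pi.one_def]

/-- A function orthogonal to every indicator of `(0, t]` vanishes almost everywhere on the positive
half-line, so it is orthogonal to `f`. Thus `f` lies in the double orthogonal complement, which is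
the closure. Step functions live on the positive half-line, whence `hf0`. -/
lemma mem_closure_range_stepFunLp {f : ℝ → ℝ} (hf : MemLp f 2 volume)
    (hf0 : ∀ x ≤ 0, f x = 0) : hf.toLp f ∈ closure (Set.range stepFunLp) := by
  have key : hf.toLp f ∈ (LinearMap.range stepFunLp)ᗮᗮ := by
    refine (Submodule.mem_orthogonal _ _).2 fun g hg ↦ ?_
    rw [Submodule.mem_orthogonal] at hg
    have hloc : LocallyIntegrable g volume := (Lp.memLp g).locallyIntegrable (by norm_num)
    have hz : ∀ᵐ x, 0 < x → g x = 0 := by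
      refine ae_eq_zero_of_integral_Ioc_eq_zero hloc fun t ↦ ?_
      have h := hg _ ⟨Finsupp.single t 1, rfl⟩
      rw [L2.inner_def] at h
      refine Eq.trans ?_ h
      rw [← integral_indicator measurableSet_Ioc]
      refine integral_congr_ae ?_
      filter_upwards [(memLp_stepFun (Finsupp.single t 1)).coeFn_toLp] with x hx
      have hx' : stepFunLp (Finsupp.single t 1) x = stepFun (Finsupp.single t 1) x := hx
      rw [hx', stepFun_single]
      by_cases hxt : x ∈ Set.Ioc (0 : ℝ) t
      · rw [Set.indicator_of_mem hxt, Set.indicator_of_mem hxt]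
        simp
      · rw [Set.indicator_of_notMem hxt, Set.indicator_of_notMem hxt]
        simp
    rw [L2.inner_def]
    refine (integral_congr_ae (g := fun _ ↦ 0) ?_).trans (by simp)
    filter_upwards [hz, hf.coeFn_toLp] with x hx hfx
    rcases le_or_gt x 0 with h | h
    · simp [hfx, hf0 x h]
    · simp [hx h]
  rw [Submodule.orthogonal_orthogonal_eq_closure] at key
  exact key

/-! ### Existence, uniqueness and linearity of the Wiener integral -/

/-- Restates the definition in the Hilbert spaces, where linearity and the isometry are available.
-/
lemma isWienerIntegral_iff (hW : IsPreBrownianReal W P) {f : ℝ → ℝ} (hf : MemLp f 2 volume)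
    {Y : Ω → ℝ} : IsWienerIntegral W P f Y ↔ ∃ hY : MemLp Y 2 P, ∃ φ : ℕ → (ℝ≥0 →₀ ℝ),
      Tendsto (fun n ↦ stepFunLp (φ n)) atTop (𝓝 (hf.toLp f)) ∧
      Tendsto (fun n ↦ stepIntegralLp hW (φ n)) atTop (𝓝 (hY.toLp Y)) := by
  have h1 (φ : ℕ → (ℝ≥0 →₀ ℝ)) := Lp.tendsto_Lp_iff_tendsto_eLpNorm'' (fi := atTop)
    (fun n ↦ stepFun (φ n)) (fun n ↦ memLp_stepFun (φ n)) f hf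
  have h2 (φ : ℕ → (ℝ≥0 →₀ ℝ)) (hY : MemLp Y 2 P) :=
    Lp.tendsto_Lp_iff_tendsto_eLpNorm'' (fi := atTop)
    (fun n ↦ stepIntegral W (φ n)) (fun n ↦ memLp_stepIntegral hW (φ n)) Y hY
  constructor
  · rintro ⟨hY, φ, hφ1, hφ2⟩
    exact ⟨hY, φ, (h1 φ).2 hφ1, (h2 φ hY).2 hφ2⟩
  · rintro ⟨hY, φ, hφ1, hφ2⟩
    exact ⟨hY, φ, (h1 φ).1 hφ1, (h2 φ hY).1 hφ2⟩

/-- The isometry turns an approximating sequence of `f` into a Cauchy sequence in `L²(P)`, which is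
complete. -/
lemma exists_isWienerIntegral (hW : IsPreBrownianReal W P) {f : ℝ → ℝ} (hf : MemLp f 2 volume)
    (hf0 : ∀ x ≤ 0, f x = 0) : ∃ Y, IsWienerIntegral W P f Y := by
  obtain ⟨x, hx, hlim⟩ := mem_closure_iff_seq_limit.1 (mem_closure_range_stepFunLp hf hf0)
  choose φ hφ using hx
  obtain rfl : (fun n ↦ stepFunLp (φ n)) = x := funext hφ
  have hc : CauchySeq fun n ↦ stepIntegralLp hW (φ n) := by
    have := hlim.cauchySeq
    rw [Metric.cauchySeq_iff] at this ⊢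
    refine fun ε hε ↦ (this ε hε).imp fun N hN m hm n hn ↦ ?_
    have := hN m hm n hn
    rwa [dist_eq_norm, ← map_sub, ← norm_stepIntegralLp hW, map_sub, ← dist_eq_norm] at this
  obtain ⟨Y, hY⟩ := cauchySeq_tendsto_of_complete hc
  refine ⟨Y, (isWienerIntegral_iff hW hf).2 ⟨Lp.memLp Y, φ, hlim, ?_⟩⟩
  rwa [Lp.toLp_coeFn]

lemma IsWienerIntegral.add (hW : IsPreBrownianReal W P) {f g : ℝ → ℝ} (hf : MemLp f 2 volume)
    (hg : MemLp g 2 volume) {Y Z : Ω → ℝ} (hY : IsWienerIntegral W P f Y)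
    (hZ : IsWienerIntegral W P g Z) : IsWienerIntegral W P (f + g) (Y + Z) := by
  obtain ⟨hY, φ, h1, h2⟩ := (isWienerIntegral_iff hW hf).1 hY
  obtain ⟨hZ, ψ, h3, h4⟩ := (isWienerIntegral_iff hW hg).1 hZ
  refine (isWienerIntegral_iff hW (hf.add hg)).2 ⟨hY.add hZ, fun n ↦ φ n + ψ n, ?_, ?_⟩
  · simpa only [map_add, MemLp.toLp_add hf hg] using h1.add h3
  · simpa only [map_add, MemLp.toLp_add hY hZ] using h2.add h4

lemma IsWienerIntegral.smul (hW : IsPreBrownianReal W P) {f : ℝ → ℝ} (hf : MemLp f 2 volume)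
    {Y : Ω → ℝ} (hY : IsWienerIntegral W P f Y) (a : ℝ) :
    IsWienerIntegral W P (a • f) (a • Y) := by
  obtain ⟨hY, φ, h1, h2⟩ := (isWienerIntegral_iff hW hf).1 hY
  refine (isWienerIntegral_iff hW (hf.const_smul a)).2 ⟨hY.const_smul a, fun n ↦ a • φ n, ?_, ?_⟩
  · simpa only [map_smul, MemLp.toLp_const_smul a hf] using h1.const_smul a
  · simpa only [map_smul, MemLp.toLp_const_smul a hY] using h2.const_smul a

lemma isWienerIntegral_zero (hW : IsPreBrownianReal W P) : IsWienerIntegral W P 0 0 := by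
  refine (isWienerIntegral_iff hW MemLp.zero).2 ⟨MemLp.zero, fun _ ↦ 0, ?_, ?_⟩ <;>
    simp [MemLp.toLp_zero]

lemma IsWienerIntegral.sum (hW : IsPreBrownianReal W P) {ι : Type*} (s : Finset ι)
    {f : ι → ℝ → ℝ} (hf : ∀ i ∈ s, MemLp (f i) 2 volume) {Y : ι → Ω → ℝ}
    (hY : ∀ i ∈ s, IsWienerIntegral W P (f i) (Y i)) :
    IsWienerIntegral W P (∑ i ∈ s, f i) (∑ i ∈ s, Y i) := by
  classical
  induction s using Finset.induction_on with
  | empty => simpa using isWienerIntegral_zero hW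
  | insert i s hi ih =>
    rw [Finset.sum_insert hi, Finset.sum_insert hi]
    refine IsWienerIntegral.add hW (hf i (by simp))
      (memLp_finsetSum' _ fun j hj ↦ hf j (by simp [hj]))
      (hY i (by simp)) (ih (fun j hj ↦ hf j (by simp [hj])) fun j hj ↦ hY j (by simp [hj]))

lemma IsWienerIntegral.norm_eq (hW : IsPreBrownianReal W P) {f : ℝ → ℝ} (hf : MemLp f 2 volume)
    {Y : Ω → ℝ} (hY : IsWienerIntegral W P f Y) :
    ‖hY.memLp.toLp Y‖ = ‖hf.toLp f‖ := by
  obtain ⟨hY', φ, h1, h2⟩ := (isWienerIntegral_iff hW hf).1 hY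
  refine tendsto_nhds_unique h2.norm ?_
  simp_rw [norm_stepIntegralLp hW]
  exact h1.norm

/-- The difference is a Wiener integral of `0`, so it has norm `0`. This makes the choice in
`wienerIntegral` harmless. -/
lemma IsWienerIntegral.ae_eq (hW : IsPreBrownianReal W P) {f : ℝ → ℝ} (hf : MemLp f 2 volume)
    {Y Z : Ω → ℝ} (hY : IsWienerIntegral W P f Y) (hZ : IsWienerIntegral W P f Z) :
    Y =ᵐ[P] Z := by
  have h := hY.add hW hf (hf.const_smul (-1 : ℝ)) (hZ.smul hW hf (-1))
  have h' := h.norm_eq hW (hf.add (hf.const_smul (-1 : ℝ)))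
  have h0 : (hf.add (hf.const_smul (-1 : ℝ))).toLp (f + (-1 : ℝ) • f) = 0 := by
    rw [Lp.eq_zero_iff_ae_eq_zero]
    filter_upwards with x
    simp
  rw [h0, norm_zero, norm_eq_zero, Lp.eq_zero_iff_ae_eq_zero] at h'
  filter_upwards [h', h.memLp.coeFn_toLp] with ω h1 h2
  rw [h1] at h2
  simp at h2
  linarith

/-- Convergence in `L²` implies convergence in law, and the characteristic functions of the
approximating centred Gaussians converge because their variances do, by the isometry. -/
lemma IsWienerIntegral.map_eq (hW : IsPreBrownianReal W P) {f : ℝ → ℝ} (hf : MemLp f 2 volume)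
    {Y : Ω → ℝ} (hY : IsWienerIntegral W P f Y) :
    P.map Y = gaussianReal 0 (∫ x, f x ^ 2).toNNReal := by
  have := hW.isGaussianProcess.isProbabilityMeasure
  obtain ⟨hY', ψ, h1, h2⟩ := (isWienerIntegral_iff hW hf).1 hY
  have hm (n) : AEMeasurable (stepIntegral W (ψ n)) P :=
    (memLp_stepIntegral hW (ψ n)).aestronglyMeasurable.aemeasurable
  have h3 : Tendsto (fun n ↦ eLpNorm (stepIntegral W (ψ n) - Y) 2 P) atTop (𝓝 0) :=
    (Lp.tendsto_Lp_iff_tendsto_eLpNorm'' (fun n ↦ stepIntegral W (ψ n))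
      (fun n ↦ memLp_stepIntegral hW (ψ n)) Y hY').1 h2
  have h4 := (tendstoInMeasure_of_tendsto_eLpNorm two_ne_zero
    (fun n ↦ (memLp_stepIntegral hW (ψ n)).aestronglyMeasurable) hY'.aestronglyMeasurable
    h3).tendstoInDistribution hm
  have h5 := ProbabilityMeasure.tendsto_iff_tendsto_charFun.1 h4.tendsto
  have := Measure.isProbabilityMeasure_map (μ := P) hY'.aestronglyMeasurable.aemeasurable
  refine Measure.ext_of_charFun (funext fun t ↦ tendsto_nhds_unique (h5 t) ?_)
  simp only [ProbabilityMeasure.coe_mk, map_stepIntegral hW, charFun_gaussianReal,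
    ← norm_toLp_sq hf]
  refine (Complex.continuous_exp.tendsto _).comp (Tendsto.sub tendsto_const_nhds ?_)
  refine Tendsto.div_const (Tendsto.mul_const _ ?_) _
  have h6 := ((continuous_real_toNNReal.tendsto _).comp (h1.norm.pow 2))
  exact (Complex.continuous_ofReal.tendsto _).comp ((NNReal.continuous_coe.tendsto _).comp h6)

lemma isWienerIntegral_congr {f g : ℝ → ℝ} (h : f =ᵐ[volume] g) :
    IsWienerIntegral W P f = IsWienerIntegral W P g := by
  have key (c : ℝ≥0 →₀ ℝ) : eLpNorm (fun x ↦ stepFun c x - f x) 2 volume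
      = eLpNorm (fun x ↦ stepFun c x - g x) 2 volume :=
    eLpNorm_congr_ae (h.mono fun x hx ↦ by simp [hx])
  ext Y
  constructor <;> rintro ⟨hY, φ, h1, h2⟩ <;> refine ⟨hY, φ, ?_, h2⟩
  · simpa only [key] using h1
  · simpa only [key] using h1

lemma wienerIntegral_congr {f g : ℝ → ℝ} {a b : ℝ}
    (h : (Set.Ioc a b).indicator f =ᵐ[volume] (Set.Ioc a b).indicator g) :
    wienerIntegral W P f a b = wienerIntegral W P g a b := by
  unfold wienerIntegral
  rw [isWienerIntegral_congr h]

lemma isWienerIntegral_wienerIntegral (hW : IsPreBrownianReal W P) {f : ℝ → ℝ} {a b : ℝ}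
    (ha : 0 ≤ a) (hf : MemLp ((Set.Ioc a b).indicator f) 2 volume) :
    IsWienerIntegral W P ((Set.Ioc a b).indicator f) (wienerIntegral W P f a b) := by
  have h : ∃ Y, IsWienerIntegral W P ((Set.Ioc a b).indicator f) Y :=
    exists_isWienerIntegral hW hf fun x hx ↦
      Set.indicator_of_notMem (fun h ↦ by linarith [h.1]) _
  unfold wienerIntegral
  rw [dif_pos h]
  exact h.choose_spec

lemma wienerIntegral_add_adjacent (hW : IsPreBrownianReal W P) {f : ℝ → ℝ} {a b c : ℝ}
    (ha : 0 ≤ a) (hab : a ≤ b) (hbc : b ≤ c) (hf : MemLp ((Set.Ioc a c).indicator f) 2 volume) :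
    ∀ᵐ ω ∂P, wienerIntegral W P f a c ω
      = wienerIntegral W P f a b ω + wienerIntegral W P f b c ω := by
  have h1 : MemLp ((Set.Ioc a b).indicator f) 2 volume := by
    convert! hf.indicator (measurableSet_Ioc (a := a) (b := b)) using 1
    rw [Set.indicator_indicator, Set.inter_eq_left.2 (Set.Ioc_subset_Ioc_right hbc)]
  have h2 : MemLp ((Set.Ioc b c).indicator f) 2 volume := by
    convert! hf.indicator (measurableSet_Ioc (a := b) (b := c)) using 1
    rw [Set.indicator_indicator, Set.inter_eq_left.2 (Set.Ioc_subset_Ioc_left hab)]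
  have h3 := (isWienerIntegral_wienerIntegral hW ha h1).add hW h1 h2
    (isWienerIntegral_wienerIntegral hW (ha.trans hab) h2)
  have h4 := Set.indicator_union_of_disjoint
    (Set.Ioc_disjoint_Ioc_of_le (a := a) (d := c) (le_refl b)) f
  rw [Set.Ioc_union_Ioc_eq_Ioc hab hbc] at h4
  change IsWienerIntegral W P (fun x ↦ _ + _) _ at h3
  rw [← h4] at h3
  exact (isWienerIntegral_wienerIntegral hW ha hf).ae_eq hW hf h3

/-- Wiener integrals of square integrable functions with disjoint supports are independent. -/
lemma iIndepFun_of_isWienerIntegral (hW : IsPreBrownianReal W P) {ι : Type*}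
    {f : ι → ℝ → ℝ} (hf : ∀ i, MemLp (f i) 2 volume) {Y : ι → Ω → ℝ}
    (hY : ∀ i, IsWienerIntegral W P (f i) (Y i)) (hd : ∀ i j, i ≠ j → ∀ x, f i x * f j x = 0) :
    iIndepFun Y P := by
  have := hW.isGaussianProcess.isProbabilityMeasure
  have hYm (i) : AEMeasurable (Y i) P := (hY i).memLp.aestronglyMeasurable.aemeasurable
  rw [iIndepFun_iff_finset]
  intro s
  refine (iIndepFun_iff_charFun_pi (X := s.restrict Y) fun i : s ↦ hYm i).2 ?_
  intro t
  have hL := IsWienerIntegral.sum hW Finset.univ (f := fun i : s ↦ t i • f i)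
    (Y := fun i : s ↦ t i • Y i) (fun i _ ↦ (hf i).const_smul _)
    fun i _ ↦ (hY i).smul hW (hf i) _
  have hLm : MemLp (∑ i : s, t i • f i) 2 volume :=
    memLp_finsetSum' _ fun i _ ↦ (hf i).const_smul _
  -- The joint characteristic function at `t` is that of the scalar `∑ t i • Y i` at `1`, and this
  -- sum is again a Wiener integral, so its law is known.
  have h1 : charFun (P.map fun ω ↦ WithLp.toLp 2 fun i : s ↦ s.restrict Y i ω) t
      = charFun (P.map (∑ i : s, t i • Y i)) 1 := by
    rw [charFun_apply, charFun_apply, integral_map, integral_map]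
    · refine integral_congr_ae (ae_of_all _ fun ω ↦ ?_)
      simp [PiLp.inner_apply, mul_comm]
    · exact hL.memLp.aestronglyMeasurable.aemeasurable
    · fun_prop
    · exact (MeasurableEquiv.toLp 2 (s → ℝ)).measurable.comp_aemeasurable
        (aemeasurable_pi_lambda _ fun i ↦ hYm i)
    · fun_prop
  -- Disjoint supports kill the cross terms: the variance is additive, so the joint characteristic
  -- function factorises.
  have h2 : ∫ x, (∑ i : s, t i • f i) x ^ 2 = ∑ i : s, t i ^ 2 * ∫ x, f i x ^ 2 := by
    have h3 (x : ℝ) : (∑ i : s, t i • f i) x ^ 2 = ∑ i : s, t i ^ 2 * f i x ^ 2 := by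
      rw [sq, Finset.sum_apply, Finset.sum_mul_sum]
      refine Finset.sum_congr rfl fun i _ ↦ ?_
      rw [Finset.sum_eq_single i]
      · simp; ring
      · intro j _ hj
        have := hd i j (fun h ↦ hj (Subtype.ext h.symm)) x
        simp only [Pi.smul_apply, smul_eq_mul]
        linear_combination t i * t j * this
      · simp
    simp_rw [h3]
    rw [integral_finsetSum _ fun (i : s) _ ↦ ((hf i).integrable_sq).const_mul _]
    simp_rw [integral_const_mul]
  have hnn (i : s) : 0 ≤ ∫ x, f i x ^ 2 := integral_nonneg fun x ↦ sq_nonneg _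
  rw [h1, hL.map_eq hW hLm, h2, charFun_gaussianReal]
  simp only [Finset.restrict, (hY _).map_eq hW (hf _), charFun_gaussianReal]
  rw [← Complex.exp_sum]
  congr 1
  rw [Real.coe_toNNReal _ (Finset.sum_nonneg fun i _ ↦ mul_nonneg (sq_nonneg _) (hnn i))]
  simp only [Real.coe_toNNReal _ (hnn _)]
  push_cast
  simp only [mul_zero, zero_mul, zero_sub, one_pow, mul_one, Finset.sum_neg_distrib,
    Finset.sum_div]
  congr 1
  exact Finset.sum_congr rfl fun i _ ↦ by ring

end VolTarget

namespace VolTarget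

/-! ### Exponential moving averages of squares -/

/-- The exponential moving average with weight `lam`, initial value `v₀` and time step `h` of the
squares of the sequence `x`. -/
noncomputable def ema (lam v₀ h : ℝ) (x : ℕ → ℝ) : ℕ → ℝ
  | 0 => v₀
  | n + 1 => lam * ema lam v₀ h x n + (1 - lam) / h * x n ^ 2

section ema

variable {lam v₀ h : ℝ} {x y : ℕ → ℝ}

lemma ema_pos (hlam : lam ∈ Set.Ioo (0 : ℝ) 1) (hv₀ : 0 < v₀) (hh : 0 < h) (n : ℕ) :
    0 < ema lam v₀ h x n := by
  induction n with
  | zero => exact hv₀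
  | succ n ih =>
    have h1 := mul_pos hlam.1 ih
    have h2 := mul_nonneg (div_pos (sub_pos.2 hlam.2) hh).le (sq_nonneg (x n))
    simp only [ema]
    linarith

/-- The weights `lam` and `1 - lam` form a convex combination, so an error of `d * h` in each square
costs only `d`, whatever the number of steps. -/
lemma abs_ema_sub_le (hlam : lam ∈ Set.Ioo (0 : ℝ) 1) (hh : 0 < h) {d : ℝ} (hd : 0 ≤ d) (n : ℕ)
    (hxy : ∀ k < n, |x k ^ 2 - y k ^ 2| ≤ d * h) :
    |ema lam v₀ h x n - ema lam v₀ h y n| ≤ d := by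
  induction n with
  | zero => simpa [ema]
  | succ n ih =>
    have h1 := ih fun k hk ↦ hxy k (by omega)
    have h2 := hxy n (by omega)
    have h3 : 0 ≤ (1 - lam) / h := (div_pos (sub_pos.2 hlam.2) hh).le
    have h4 : ema lam v₀ h x (n + 1) - ema lam v₀ h y (n + 1)
        = lam * (ema lam v₀ h x n - ema lam v₀ h y n)
          + (1 - lam) / h * (x n ^ 2 - y n ^ 2) := by simp only [ema]; ring
    calc |ema lam v₀ h x (n + 1) - ema lam v₀ h y (n + 1)|
        ≤ lam * |ema lam v₀ h x n - ema lam v₀ h y n|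
          + (1 - lam) / h * |x n ^ 2 - y n ^ 2| := by
          rw [h4]
          refine (abs_add_le _ _).trans ?_
          rw [abs_mul, abs_mul, abs_of_pos hlam.1, abs_of_nonneg h3]
      _ ≤ lam * d + (1 - lam) / h * (d * h) := by
          have := hlam.1
          gcongr
      _ = d := by field_simp; ring

lemma pow_mul_ema_le (hlam : lam ∈ Set.Ioo (0 : ℝ) 1) (hh : 0 < h) (n m : ℕ) :
    lam ^ m * ema lam v₀ h x n ≤ ema lam v₀ h x (n + m) := by
  induction m with
  | zero => simp
  | succ m ih =>
    have h1 := mul_le_mul_of_nonneg_left ih hlam.1.le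
    have h2 := mul_nonneg (div_pos (sub_pos.2 hlam.2) hh).le (sq_nonneg (x (n + m)))
    rw [← add_assoc]
    simp only [ema]
    rw [pow_succ']
    linarith

/-- All terms are nonnegative, so each of the last `m` squares survives with a weight of at least
`lam ^ m`. A small average therefore forces all of them to be small at once. -/
lemma pow_mul_sq_le_ema (hlam : lam ∈ Set.Ioo (0 : ℝ) 1) (hv₀ : 0 < v₀) (hh : 0 < h) (n : ℕ)
    {j m : ℕ} (hj : j < m) :
    lam ^ m * ((1 - lam) / h * x (n + j) ^ 2) ≤ ema lam v₀ h x (n + m) := by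
  have h0 : 0 ≤ (1 - lam) / h * x (n + j) ^ 2 :=
    mul_nonneg (div_pos (sub_pos.2 hlam.2) hh).le (sq_nonneg _)
  have h1 : (1 - lam) / h * x (n + j) ^ 2 ≤ ema lam v₀ h x (n + j + 1) := by
    have := mul_pos hlam.1 (ema_pos (x := x) hlam hv₀ hh (n + j))
    simp only [ema]
    linarith
  have h2 := pow_mul_ema_le (v₀ := v₀) (x := x) hlam hh (n + j + 1) (m - (j + 1))
  rw [show n + j + 1 + (m - (j + 1)) = n + m by omega] at h2
  refine le_trans ?_ h2
  have h3 : lam ^ m ≤ lam ^ (m - (j + 1)) :=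
    pow_le_pow_of_le_one hlam.1.le hlam.2.le (by omega)
  exact mul_le_mul h3 h1 h0 (pow_nonneg hlam.1.le _)

lemma pow_mul_initial_le_ema (hlam : lam ∈ Set.Ioo (0 : ℝ) 1) (hv₀ : 0 < v₀) (hh : 0 < h)
    {n m : ℕ} (hn : n ≤ m) : lam ^ m * v₀ ≤ ema lam v₀ h x n := by
  have h1 := pow_mul_ema_le (v₀ := v₀) (x := x) hlam hh 0 n
  rw [zero_add] at h1
  refine le_trans ?_ h1
  exact mul_le_mul_of_nonneg_right (pow_le_pow_of_le_one hlam.1.le hlam.2.le hn) hv₀.le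

lemma measurable_ema {α : Type*} [MeasurableSpace α] {x : ℕ → α → ℝ} (n : ℕ)
    (hx : ∀ k < n, Measurable (x k)) :
    Measurable fun a ↦ ema lam v₀ h (fun k ↦ x k a) n := by
  induction n with
  | zero => exact measurable_const
  | succ n ih =>
    exact ((ih fun k hk ↦ hx k (by omega)).const_mul _).add
      (((hx n (by omega)).pow_const 2).const_mul _)

end ema

/-! ### Deterministic estimates -/

/-- Factor the difference of squares: by the second order Taylor bound, `exp (a + x) - 1 - x` is of
order `g^32`, while the sum `exp (a + x) - 1 + x` is of order `g^16`. -/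
lemma abs_exp_sub_one_sq_sub_sq_le {A g a x : ℝ} (hA : 0 ≤ A) (hg : 0 < g) (hg1 : g ≤ 1)
    (hgA : (A + 1) * g ≤ 1) (ha : |a| ≤ A * g ^ 40) (hx : |x| ≤ g ^ 16) :
    |(Real.exp (a + x) - 1) ^ 2 - x ^ 2|
      ≤ (2 * (A + 1) ^ 2 * (2 * (A + 1) ^ 2 + 2)) * g ^ 48 := by
  have p1 : g ^ 40 ≤ g ^ 16 := pow_le_pow_of_le_one hg.le hg1 (by norm_num)
  have p2 : g ^ 16 ≤ g := pow_le_of_le_one hg.le hg1 (by norm_num)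
  have p3 : g ^ 40 ≤ g ^ 32 := pow_le_pow_of_le_one hg.le hg1 (by norm_num)
  have p4 : g ^ 32 ≤ g ^ 16 := pow_le_pow_of_le_one hg.le hg1 (by norm_num)
  have p5 : 0 < g ^ 32 := by positivity
  have h1 : |a + x| ≤ (A + 1) * g ^ 16 :=
    (abs_add_le _ _).trans (by nlinarith)
  have h2 : |a + x| ≤ 1 := h1.trans (le_trans (by gcongr) hgA)
  have h3 := Real.abs_exp_sub_one_sub_id_le h2
  have h4 : (a + x) ^ 2 ≤ (A + 1) ^ 2 * g ^ 32 := by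
    rw [← sq_abs]
    calc |a + x| ^ 2 ≤ ((A + 1) * g ^ 16) ^ 2 := by gcongr
      _ = _ := by ring
  have h5 : |Real.exp (a + x) - 1 - x| ≤ 2 * (A + 1) ^ 2 * g ^ 32 := by
    have e : Real.exp (a + x) - 1 - x = (Real.exp (a + x) - 1 - (a + x)) + a := by ring
    rw [e]
    refine (abs_add_le _ _).trans ?_
    nlinarith [mul_le_mul_of_nonneg_left p3 hA]
  have h6 : |Real.exp (a + x) - 1 + x| ≤ (2 * (A + 1) ^ 2 + 2) * g ^ 16 := by
    have e : Real.exp (a + x) - 1 + x = (Real.exp (a + x) - 1 - x) + 2 * x := by ring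
    rw [e]
    refine (abs_add_le _ _).trans ?_
    rw [abs_mul, abs_two]
    have := mul_le_mul_of_nonneg_left p4 (by positivity : 0 ≤ 2 * (A + 1) ^ 2)
    linarith
  calc |(Real.exp (a + x) - 1) ^ 2 - x ^ 2|
      = |Real.exp (a + x) - 1 - x| * |Real.exp (a + x) - 1 + x| := by
        rw [← abs_mul]; ring_nf
    _ ≤ (2 * (A + 1) ^ 2 * g ^ 32) * ((2 * (A + 1) ^ 2 + 2) * g ^ 16) := by gcongr
    _ = _ := by ring

lemma abs_inv_sub_inv_le_of_sq_le {g C u v : ℝ} (hg : 0 < g) (hu : g ^ 2 ≤ u)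
    (hv : g ^ 2 / 4 ≤ v) (huv : |v - u| ≤ C * g ^ 8) : |v⁻¹ - u⁻¹| ≤ 4 * C * g ^ 4 := by
  have hu0 : 0 < u := lt_of_lt_of_le (by positivity) hu
  have hv0 : 0 < v := lt_of_lt_of_le (by positivity) hv
  rw [inv_sub_inv hv0.ne' hu0.ne', abs_div, abs_of_pos (mul_pos hv0 hu0), abs_sub_comm,
    div_le_iff₀ (mul_pos hv0 hu0)]
  have h0 : 0 ≤ C * g ^ 8 := (abs_nonneg _).trans huv
  have hC : 0 ≤ C := nonneg_of_mul_nonneg_left h0 (by positivity)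
  calc |v - u| ≤ C * g ^ 8 := huv
    _ = 4 * C * g ^ 4 * (g ^ 2 / 4 * g ^ 2) := by ring
    _ ≤ _ := by gcongr

lemma abs_inv_sqrt_sub_inv_sqrt_le {g C u v : ℝ} (hg : 0 < g) (hu : g ^ 2 ≤ u)
    (hv : g ^ 2 / 4 ≤ v) (huv : |v - u| ≤ C * g ^ 8) :
    |(√v)⁻¹ - (√u)⁻¹| ≤ 2 * C * g ^ 5 := by
  have hu0 : 0 < u := lt_of_lt_of_le (by positivity) hu
  have hv0 : 0 < v := lt_of_lt_of_le (by positivity) hv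
  have hsu : g ≤ √u := Real.le_sqrt_of_sq_le hu
  have hsv : g / 2 ≤ √v :=
    Real.le_sqrt_of_sq_le (by linarith [show (g / 2) ^ 2 = g ^ 2 / 4 by ring])
  have hsu0 := hg.trans_le hsu
  have hsv0 := (half_pos hg).trans_le hsv
  have h0 : 0 ≤ C * g ^ 8 := (abs_nonneg _).trans huv
  have hC : 0 ≤ C := nonneg_of_mul_nonneg_left h0 (by positivity)
  have h1 : |√v - √u| ≤ C * g ^ 7 := by
    have e : |v - u| = |√v - √u| * (√v + √u) := by
      nth_rewrite 1 [← abs_of_pos (add_pos hsv0 hsu0), ← Real.sq_sqrt hv0.le,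
        ← Real.sq_sqrt hu0.le]
      rw [← abs_of_pos (add_pos hsv0 hsu0), ← abs_mul, abs_of_pos (add_pos hsv0 hsu0)]
      ring_nf
    rw [e] at huv
    have h2 : |√v - √u| * g ≤ C * g ^ 7 * g :=
      calc |√v - √u| * g ≤ |√v - √u| * (√v + √u) := by gcongr; linarith
        _ ≤ C * g ^ 8 := huv
        _ = _ := by ring
    exact le_of_mul_le_mul_right h2 hg
  rw [inv_sub_inv hsv0.ne' hsu0.ne', abs_div, abs_of_pos (mul_pos hsv0 hsu0), abs_sub_comm,
    div_le_iff₀ (mul_pos hsv0 hsu0)]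
  calc |√v - √u| ≤ C * g ^ 7 := h1
    _ = 2 * C * g ^ 5 * (g / 2 * g) := by ring
    _ ≤ _ := by gcongr

/-! ### Gaussian estimates -/

/-- Markov's inequality for the 20th moment, which scales as `v ^ 10`. With `v` of order `g^40` and
`x = g^16` the bound is of order `g^80`. -/
lemma gaussianReal_abs_gt_le (v : ℝ≥0) {x : ℝ} (hx : 0 < x) :
    (gaussianReal 0 v).real {y | x < |y|}
      ≤ (∫ y, y ^ 20 ∂(gaussianReal 0 1)) * v ^ 10 / x ^ 20 := by
  have hmap : (gaussianReal 0 1).map (√(v : ℝ) * ·) = gaussianReal 0 v := by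
    rw [gaussianReal_map_const_mul]
    congr 1
    · simp
    · ext; simp
  have hint : Integrable (fun y : ℝ ↦ y ^ 20) (gaussianReal 0 v) := by
    have h : MemLp id ((20 : ℕ) : ℝ≥0∞) (gaussianReal 0 v) :=
      (IsGaussian.hasGaussianLaw_id (μ := gaussianReal 0 v)).memLp (by simp)
    refine h.integrable_norm_pow'.congr (ae_of_all _ fun y ↦ ?_)
    simp [Even.pow_abs (show Even 20 by decide)]
  have h1 : ∫ y, y ^ 20 ∂(gaussianReal 0 v) = (∫ y, y ^ 20 ∂(gaussianReal 0 1)) * v ^ 10 := by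
    rw [← hmap, integral_map (by fun_prop) (by fun_prop), ← integral_mul_const]
    refine integral_congr_ae (ae_of_all _ fun y ↦ ?_)
    have : √(v : ℝ) ^ 20 = (v : ℝ) ^ 10 := by
      rw [show 20 = 2 * 10 by rfl, pow_mul, Real.sq_sqrt (NNReal.coe_nonneg v)]
    simp only [mul_pow, this]
    ring
  have h2 := mul_meas_ge_le_integral_of_nonneg (μ := gaussianReal 0 v)
    (ae_of_all _ fun y : ℝ ↦ (by positivity : 0 ≤ y ^ 20)) hint (x ^ 20)
  rw [h1] at h2
  rw [le_div_iff₀ (by positivity), mul_comm]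
  refine le_trans ?_ h2
  refine mul_le_mul_of_nonneg_left (measureReal_mono fun y hy ↦ ?_) (by positivity)
  · have : x ^ 20 ≤ |y| ^ 20 := pow_le_pow_left₀ hx.le (le_of_lt hy) 20
    rwa [Even.pow_abs (by decide)] at this

/-- The density is at most `1 / √(2πv)`, the interval has length `2x`, and `2 ≤ √(2π)`. -/
lemma gaussianReal_Icc_le {v : ℝ≥0} (hv : v ≠ 0) {x : ℝ} (hx : 0 ≤ x) :
    (gaussianReal 0 v).real (Set.Icc (-x) x) ≤ x / √v := by
  have hv0 : 0 < (v : ℝ) := by positivity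
  have hpdf : ∀ y, gaussianPDF 0 v y ≤ ENNReal.ofReal ((√(2 * Real.pi * v))⁻¹) := by
    intro y
    refine ENNReal.ofReal_le_ofReal ?_
    unfold gaussianPDFReal
    refine mul_le_of_le_one_right (by positivity) (Real.exp_le_one_iff.2 ?_)
    exact div_nonpos_of_nonpos_of_nonneg (neg_nonpos.2 (sq_nonneg _)) (by positivity)
  have h1 : gaussianReal 0 v (Set.Icc (-x) x)
      ≤ ENNReal.ofReal ((√(2 * Real.pi * v))⁻¹ * (2 * x)) := by
    rw [gaussianReal_apply _ hv]
    refine (setLIntegral_mono measurable_const fun y _ ↦ hpdf y).trans ?_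
    rw [setLIntegral_const, Real.volume_Icc, ← ENNReal.ofReal_mul (by positivity)]
    gcongr
    linarith
  have h2 := ENNReal.toReal_le_of_le_ofReal (by positivity) h1
  refine h2.trans ?_
  have h3 : 2 * √(v : ℝ) ≤ √(2 * Real.pi * v) := by
    refine Real.le_sqrt_of_sq_le ?_
    rw [mul_pow, Real.sq_sqrt hv0.le]
    nlinarith [Real.pi_gt_three]
  rw [inv_mul_eq_div, div_le_div_iff₀ (by positivity) (by positivity)]
  nlinarith

end VolTarget

namespace VolTarget

variable {Ω : Type*} [MeasurableSpace Ω] {P : Measure Ω}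

/-! ### The good event -/

lemma measureReal_abs_gt_le {ξ : Ω → ℝ} (hξ : Measurable ξ) {v : ℝ≥0}
    (hlaw : P.map ξ = gaussianReal 0 v) {shi g : ℝ} (hg : 0 < g) (hv : v ≤ shi ^ 2 * g ^ 40) :
    P.real {ω | g ^ 16 < |ξ ω|} ≤ (∫ y, y ^ 20 ∂(gaussianReal 0 1)) * shi ^ 20 * g ^ 80 := by
  have h1 : P.real {ω | g ^ 16 < |ξ ω|} = (gaussianReal 0 v).real {y | g ^ 16 < |y|} := by
    rw [measureReal_def, measureReal_def, ← hlaw,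
      Measure.map_apply hξ (measurableSet_lt (by fun_prop) (by fun_prop))]
    rfl
  rw [h1]
  refine (gaussianReal_abs_gt_le v (by positivity)).trans ?_
  have h0 : 0 ≤ ∫ y, y ^ 20 ∂(gaussianReal 0 1) := integral_nonneg fun y ↦ by positivity
  rw [div_le_iff₀ (by positivity)]
  calc (∫ y, y ^ 20 ∂(gaussianReal 0 1)) * (v : ℝ) ^ 10
      ≤ (∫ y, y ^ 20 ∂(gaussianReal 0 1)) * (shi ^ 2 * g ^ 40) ^ 10 := by gcongr
    _ = _ := by ring

variable [IsProbabilityMeasure P]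

/-- Up to time `K` the initial value alone keeps the average above `g^2`. Later, a value below `g^2`
confines each of the last `K` independent increments to a small interval, and the probabilities
multiply. -/
lemma measureReal_ema_lt_le {ξ : ℕ → Ω → ℝ} (hξ : ∀ k, Measurable (ξ k)) (hind : iIndepFun ξ P)
    {vr : ℕ → ℝ≥0} (hlaw : ∀ k, P.map (ξ k) = gaussianReal 0 (vr k)) {lam v₀ slo g : ℝ}
    (hlam : lam ∈ Set.Ioo (0 : ℝ) 1) (hv₀ : 0 < v₀) {K : ℕ} (hslo : 0 < slo) (hg : 0 < g)
    (hvr : ∀ k, slo ^ 2 * g ^ 40 ≤ vr k) (hsmall : g ^ 2 ≤ lam ^ K * v₀) (n : ℕ) :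
    P.real {ω | ema lam v₀ (g ^ 40) (fun k ↦ ξ k ω) n < g ^ 2}
      ≤ (g / (slo * √(lam ^ K * (1 - lam)))) ^ K := by
  have hh : 0 < g ^ 40 := by positivity
  have hc : 0 < lam ^ K * (1 - lam) := mul_pos (pow_pos hlam.1 _) (sub_pos.2 hlam.2)
  rcases le_or_gt n K with hn | hn
  · have : {ω | ema lam v₀ (g ^ 40) (fun k ↦ ξ k ω) n < g ^ 2} = ∅ := by
      ext ω
      simpa using hsmall.trans (pow_mul_initial_le_ema hlam hv₀ hh hn)
    rw [this, measureReal_empty]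
    positivity
  obtain ⟨m, rfl⟩ : ∃ m, n = m + K := ⟨n - K, by omega⟩
  -- Solves `lam ^ K * (1 - lam) / g ^ 40 * x ^ 2 = g ^ 2`.
  set x := g ^ 21 / √(lam ^ K * (1 - lam)) with hxdef
  have hx : 0 ≤ x := by positivity
  have hsub : {ω | ema lam v₀ (g ^ 40) (fun k ↦ ξ k ω) (m + K) < g ^ 2}
      ⊆ ⋂ k ∈ Finset.Ico m (m + K), ξ k ⁻¹' Set.Icc (-x) x := by
    intro ω hω
    simp only [Set.mem_iInter, Finset.mem_Ico, Set.mem_preimage, Set.mem_Icc, ← abs_le]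
    intro k hk
    have h1 := pow_mul_sq_le_ema (x := fun k ↦ ξ k ω) hlam hv₀ hh m (j := k - m) (m := K) (by omega)
    have h2 := h1.trans hω.le
    simp only [show m + (k - m) = k by omega] at h2
    refine abs_le_of_sq_le_sq ?_ hx
    rw [hxdef, div_pow, Real.sq_sqrt hc.le, le_div_iff₀ hc]
    have h3 := mul_le_mul_of_nonneg_right h2 hh.le
    calc ξ k ω ^ 2 * (lam ^ K * (1 - lam))
        = lam ^ K * ((1 - lam) / g ^ 40 * ξ k ω ^ 2) * g ^ 40 := by field_simp
      _ ≤ g ^ 2 * g ^ 40 := h3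
      _ = _ := by ring
  refine (measureReal_mono hsub).trans ?_
  have hprod := hind.measure_inter_preimage_eq_mul (Finset.Ico m (m + K))
    (sets := fun _ ↦ Set.Icc (-x) x) fun _ _ ↦ measurableSet_Icc
  rw [measureReal_def, hprod, ENNReal.toReal_prod]
  have hk (k : ℕ) : (P (ξ k ⁻¹' Set.Icc (-x) x)).toReal
      ≤ g / (slo * √(lam ^ K * (1 - lam))) := by
    have hvk : 0 < (vr k : ℝ) := lt_of_lt_of_le (by positivity) (hvr k)
    have h1 : (P (ξ k ⁻¹' Set.Icc (-x) x)).toReal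
        = (gaussianReal 0 (vr k)).real (Set.Icc (-x) x) := by
      rw [measureReal_def, ← hlaw, Measure.map_apply (hξ k) measurableSet_Icc]
    rw [h1]
    refine (gaussianReal_Icc_le (by exact_mod_cast hvk.ne') hx).trans ?_
    have h2 : slo * g ^ 20 ≤ √(vr k) := by
      refine Real.le_sqrt_of_sq_le (le_trans (le_of_eq ?_) (hvr k))
      ring
    calc x / √(vr k) ≤ x / (slo * g ^ 20) := by gcongr
      _ = _ := by rw [hxdef]; field_simp
  refine (Finset.prod_le_prod (fun _ _ ↦ ENNReal.toReal_nonneg) fun k _ ↦ hk k).trans ?_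
  rw [Finset.prod_const, Nat.card_Ico, Nat.add_sub_cancel_left]

/-- Outside an event of small probability the leverages computed from the returns and from the
Gaussian increments are uniformly close. -/
theorem exists_good_event {lam v₀ slo : ℝ} (shi A : ℝ) (T : ℝ)
    (hlam : lam ∈ Set.Ioo (0 : ℝ) 1) (hv₀ : 0 < v₀) (hslo : 0 < slo) (hA : 0 ≤ A) :
    ∃ K g₀ : ℝ, 0 ≤ K ∧ 0 < g₀ ∧ ∀ (N : ℕ) (g : ℝ) (ξ : ℕ → Ω → ℝ) (a : ℕ → ℝ) (vr : ℕ → ℝ≥0),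
      0 < g → g ≤ g₀ → N * g ^ 40 = T → (∀ k, Measurable (ξ k)) → iIndepFun ξ P →
      (∀ k, P.map (ξ k) = gaussianReal 0 (vr k)) → (∀ k, slo ^ 2 * g ^ 40 ≤ vr k) →
      (∀ k, vr k ≤ shi ^ 2 * g ^ 40) → (∀ k < N, |a k| ≤ A * g ^ 40) →
      ∃ B : Set Ω, P.real B ≤ K * g ^ 40 ∧ ∀ ω ∉ B, ∀ n < N,
        |(√(ema lam v₀ (g ^ 40) (fun k ↦ Real.exp (a k + ξ k ω) - 1) n))⁻¹
          - (√(ema lam v₀ (g ^ 40) (fun k ↦ ξ k ω) n))⁻¹| ≤ K * g ^ 5 ∧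
        |(ema lam v₀ (g ^ 40) (fun k ↦ Real.exp (a k + ξ k ω) - 1) n)⁻¹
          - (ema lam v₀ (g ^ 40) (fun k ↦ ξ k ω) n)⁻¹| ≤ K * g ^ 4 := by
  -- Eighty factors of order `g` give `g^80`, which leaves `g^40` after summing over `T / g^40`
  -- windows.
  obtain ⟨q, hq⟩ : ∃ q : ℕ, q = 80 := ⟨80, rfl⟩
  set C := 2 * (A + 1) ^ 2 * (2 * (A + 1) ^ 2 + 2) with hC
  have hC0 : 0 < C := by positivity
  set m := ∫ y, y ^ 20 ∂(gaussianReal 0 1) with hm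
  have hm0 : 0 ≤ m := integral_nonneg fun y ↦ by positivity
  have hc : 0 < lam ^ q * (1 - lam) := mul_pos (pow_pos hlam.1 _) (sub_pos.2 hlam.2)
  set D := m * shi ^ 20 + (1 / (slo * √(lam ^ q * (1 - lam)))) ^ q with hD
  have hD0 : 0 ≤ D := by positivity
  have hw : 0 < lam ^ q * v₀ := mul_pos (pow_pos hlam.1 _) hv₀
  -- The bounds `1` and `1 / (A + 1)` serve the exponential estimate, `1 / (2 * C)` gives `C * g^8 ≤
  -- g^2 / 2` and so keeps `v` away from `0`, and the last one covers the first `q` windows.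
  refine ⟨max (T * D) (4 * C), min (min 1 (1 / (A + 1))) (min (1 / (2 * C)) (lam ^ q * v₀)),
    le_max_of_le_right (by positivity), by positivity, ?_⟩
  intro N g ξ a vr hg hg0 hN hξ hind hlaw hlo hhi ha
  have hg1 : g ≤ 1 := hg0.trans ((min_le_left _ _).trans (min_le_left _ _))
  have hgA : (A + 1) * g ≤ 1 := by
    have := hg0.trans ((min_le_left _ _).trans (min_le_right _ _))
    rwa [le_div_iff₀' (by positivity)] at this
  have hgC : 2 * C * g ≤ 1 := by
    have := hg0.trans ((min_le_right _ _).trans (min_le_left _ _))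
    rwa [le_div_iff₀' (by positivity)] at this
  have hsmall : g ^ 2 ≤ lam ^ q * v₀ :=
    (pow_le_of_le_one hg.le hg1 two_ne_zero).trans
      (hg0.trans ((min_le_right _ _).trans (min_le_right _ _)))
  have hh : 0 < g ^ 40 := by positivity
  refine ⟨⋃ k ∈ Finset.range N, ({ω | g ^ 16 < |ξ k ω|} ∪
    {ω | ema lam v₀ (g ^ 40) (fun k ↦ ξ k ω) k < g ^ 2}), ?_, ?_⟩
  · refine (measureReal_biUnion_finset_le _ _).trans ?_
    have hk (k : ℕ) : P.real ({ω | g ^ 16 < |ξ k ω|} ∪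
        {ω | ema lam v₀ (g ^ 40) (fun k ↦ ξ k ω) k < g ^ 2}) ≤ D * g ^ 80 := by
      refine (measureReal_union_le _ _).trans ((add_le_add
        (measureReal_abs_gt_le (hξ k) (hlaw k) hg (hhi k))
        (measureReal_ema_lt_le hξ hind hlaw hlam hv₀ hslo hg hlo hsmall k)).trans (le_of_eq ?_))
      rw [hD, div_eq_mul_one_div g, mul_pow g, hq]
      ring
    refine (Finset.sum_le_sum fun k _ ↦ hk k).trans ?_
    rw [Finset.sum_const, Finset.card_range, nsmul_eq_mul]
    calc (N : ℝ) * (D * g ^ 80) = (N * g ^ 40) * D * g ^ 40 := by ring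
      _ = T * D * g ^ 40 := by rw [hN]
      _ ≤ _ := by gcongr; exact le_max_left _ _
  · intro ω hω n hn
    simp only [Set.mem_iUnion, Finset.mem_range, Set.mem_union, Set.mem_ofPred_eq, not_exists,
      not_or, not_lt] at hω
    have hu := (hω n hn).2
    have hd : |ema lam v₀ (g ^ 40) (fun k ↦ Real.exp (a k + ξ k ω) - 1) n
        - ema lam v₀ (g ^ 40) (fun k ↦ ξ k ω) n| ≤ C * g ^ 8 := by
      refine abs_ema_sub_le hlam hh (by positivity) n fun k hk ↦ ?_
      refine (abs_exp_sub_one_sq_sub_sq_le hA hg hg1 hgA (ha k (by omega))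
        (hω k (by omega)).1).trans (le_of_eq ?_)
      ring
    have hv : g ^ 2 / 4 ≤ ema lam v₀ (g ^ 40) (fun k ↦ Real.exp (a k + ξ k ω) - 1) n := by
      have h1 : C * g ^ 8 ≤ g ^ 2 / 2 := by
        have h2 : g ^ 7 ≤ g ^ 2 := pow_le_pow_of_le_one hg.le hg1 (by norm_num)
        have h3 : 2 * C * g * g ^ 7 ≤ 1 * g ^ 7 := by gcongr
        nlinarith
      have := (abs_le.1 hd).1
      linarith [sq_nonneg g]
    refine ⟨(abs_inv_sqrt_sub_inv_sqrt_le hg hu hv hd).trans ?_,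
      (abs_inv_sub_inv_le_of_sq_le hg hu hv hd).trans ?_⟩
    · gcongr
      exact le_trans (by linarith) (le_max_right _ _)
    · gcongr
      exact le_max_right _ _

end VolTarget

namespace VolTarget

variable {Ω : Type*} [MeasurableSpace Ω] {P : Measure Ω}

/-! ### Martingale transforms of independent centred random variables -/

/-- The `σ`-algebra generated by `ξ 0, …, ξ (n - 1)`. -/
abbrev past {Ω : Type*} (ξ : ℕ → Ω → ℝ) (n : ℕ) : MeasurableSpace Ω :=
  ⨆ k ∈ Set.Iio n, MeasurableSpace.comap (ξ k) inferInstance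

lemma past_mono {Ω : Type*} (ξ : ℕ → Ω → ℝ) : Monotone (past ξ) := fun _ _ h ↦
  biSup_mono fun _ hk ↦ lt_of_lt_of_le hk h

lemma past_le {ξ : ℕ → Ω → ℝ} (hξ : ∀ k, Measurable (ξ k)) (n : ℕ) :
    past ξ n ≤ ‹MeasurableSpace Ω› :=
  iSup₂_le fun k _ ↦ (hξ k).comap_le

lemma measurable_past {Ω : Type*} (ξ : ℕ → Ω → ℝ) {k n : ℕ} (hk : k < n) :
    Measurable[past ξ n] (ξ k) :=
  measurable_iff_comap_le.2
    (le_iSup₂_of_le (f := fun k (_ : k ∈ Set.Iio n) ↦ MeasurableSpace.comap (ξ k) inferInstance)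
      k hk le_rfl)

lemma indepFun_of_measurable_past {ξ : ℕ → Ω → ℝ} (hξ : ∀ k, Measurable (ξ k))
    (hind : iIndepFun ξ P) {n : ℕ} {X : Ω → ℝ} (hX : Measurable[past ξ n] X) :
    IndepFun X (ξ n) P := by
  rw [IndepFun_iff_Indep]
  have h := indep_iSup_of_disjoint (fun k ↦ (hξ k).comap_le) hind.iIndep
    (S := Set.Iio n) (T := {n}) (by simp)
  simp only [Set.mem_singleton_iff, iSup_iSup_eq_left] at h
  exact indep_of_indep_of_le_left h hX.comap_le

/-- Orthogonality of the increments: the partial sum times `δ n` depends on the past only, hence is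
independent of the centred `ξ n`, and the cross term vanishes. Measurability and square
integrability are part of the induction because the cross term needs them. -/
lemma martingaleTransform_sq_le [IsProbabilityMeasure P] {ξ : ℕ → Ω → ℝ}
    (hξ : ∀ k, Measurable (ξ k)) (hind : iIndepFun ξ P) (hξ2 : ∀ k, MemLp (ξ k) 2 P)
    (hξ0 : ∀ k, ∫ ω, ξ k ω ∂P = 0) {s ε : ℝ} (hs : ∀ k, ∫ ω, ξ k ω ^ 2 ∂P ≤ s)
    {δ : ℕ → Ω → ℝ} (hδ : ∀ k, Measurable[past ξ k] (δ k)) (hε : ∀ k ω, |δ k ω| ≤ ε) (n : ℕ) :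
    Measurable[past ξ n] (fun ω ↦ ∑ k ∈ Finset.range n, δ k ω * ξ k ω) ∧
      MemLp (fun ω ↦ ∑ k ∈ Finset.range n, δ k ω * ξ k ω) 2 P ∧
      ∫ ω, (∑ k ∈ Finset.range n, δ k ω * ξ k ω) ^ 2 ∂P ≤ n * (ε ^ 2 * s) := by
  induction n with
  | zero => simp [measurable_const]
  | succ n ih =>
    obtain ⟨ihm, ihL, ihs⟩ := ih
    have hδm : Measurable (δ n) := (hδ n).mono (past_le hξ n) le_rfl
    have hb : MemLp (fun ω ↦ δ n ω * ξ n ω) 2 P := by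
      refine (hξ2 n).of_le_mul (c := ε) (hδm.mul (hξ n)).aestronglyMeasurable
        (ae_of_all _ fun ω ↦ ?_)
      rw [norm_mul, Real.norm_eq_abs]
      exact mul_le_mul_of_nonneg_right (hε n ω) (norm_nonneg _)
    simp_rw [Finset.sum_range_succ]
    refine ⟨?_, ihL.add hb, ?_⟩
    · refine Measurable.add (ihm.mono (past_mono ξ n.le_succ) le_rfl)
        (Measurable.mul ((hδ n).mono (past_mono ξ n.le_succ) le_rfl) ?_)
      exact measurable_past ξ n.lt_succ_self
    · set M : Ω → ℝ := fun ω ↦ ∑ k ∈ Finset.range n, δ k ω * ξ k ω with hM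
      have hMδ : Measurable[past ξ n] (fun ω ↦ M ω * δ n ω) := Measurable.mul ihm (hδ n)
      have hcross : ∫ ω, M ω * (δ n ω * ξ n ω) ∂P = 0 := by
        simp_rw [← mul_assoc]
        rw [(indepFun_of_measurable_past hξ hind hMδ).integral_fun_mul_eq_mul_integral
          (hMδ.mono (past_le hξ n) le_rfl).aestronglyMeasurable (hξ n).aestronglyMeasurable,
          hξ0, mul_zero]
      have hsq : ∫ ω, (δ n ω * ξ n ω) ^ 2 ∂P ≤ ε ^ 2 * s := by
        calc ∫ ω, (δ n ω * ξ n ω) ^ 2 ∂P ≤ ∫ ω, ε ^ 2 * ξ n ω ^ 2 ∂P := by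
              refine integral_mono hb.integrable_sq ((hξ2 n).integrable_sq.const_mul _) fun ω ↦ ?_
              simp only [mul_pow]
              refine mul_le_mul_of_nonneg_right ?_ (sq_nonneg _)
              rw [← sq_abs]
              exact pow_le_pow_left₀ (abs_nonneg _) (hε n ω) 2
          _ = ε ^ 2 * ∫ ω, ξ n ω ^ 2 ∂P := integral_const_mul _ _
          _ ≤ _ := mul_le_mul_of_nonneg_left (hs n) (sq_nonneg _)
      have hexp (ω : Ω) : (M ω + δ n ω * ξ n ω) ^ 2
          = M ω ^ 2 + 2 * (M ω * (δ n ω * ξ n ω)) + (δ n ω * ξ n ω) ^ 2 := by ring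
      have hi1 := ihL.integrable_sq
      have hi2 : Integrable (fun ω ↦ 2 * (M ω * (δ n ω * ξ n ω))) P :=
        (ihL.integrable_mul hb).const_mul 2
      change ∫ ω, (M ω + δ n ω * ξ n ω) ^ 2 ∂P ≤ _
      have hsum : ∫ ω, (M ω + δ n ω * ξ n ω) ^ 2 ∂P
          = (∫ ω, M ω ^ 2 + 2 * (M ω * (δ n ω * ξ n ω)) ∂P) + ∫ ω, (δ n ω * ξ n ω) ^ 2 ∂P := by
        simp_rw [hexp]
        exact integral_add (hi1.add hi2) hb.integrable_sq
      rw [hsum, integral_add hi1 hi2, integral_const_mul, hcross]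
      push_cast
      linarith

/-! ### Convergence in probability -/

lemma tendstoInMeasure_zero_of_bound [IsProbabilityMeasure P] {Y : ℕ → Ω → ℝ} {b q : ℕ → ℝ}
    {B : ℕ → Set Ω} (hq : Tendsto q atTop (𝓝 0)) (hb : Tendsto b atTop (𝓝 0))
    (hB : ∀ᶠ N in atTop, P.real (B N) ≤ q N) (hY : ∀ᶠ N in atTop, ∀ ω ∉ B N, |Y N ω| ≤ b N) :
    TendstoInMeasure P Y atTop 0 := by
  rw [tendstoInMeasure_iff_measureReal_norm]
  intro ε hε
  refine squeeze_zero' (Eventually.of_forall fun _ ↦ measureReal_nonneg) ?_ hq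
  filter_upwards [hB, hY, hb.eventually (gt_mem_nhds hε)] with N h1 h2 h3
  refine le_trans (measureReal_mono fun ω hω ↦ ?_) h1
  by_contra hn
  have := h2 ω hn
  simp at hω
  linarith

lemma tendstoInMeasure_zero_of_sq_le [IsProbabilityMeasure P] {Y : ℕ → Ω → ℝ} {b : ℕ → ℝ}
    (hb : Tendsto b atTop (𝓝 0)) (hL : ∀ᶠ N in atTop, MemLp (Y N) 2 P)
    (hY : ∀ᶠ N in atTop, ∫ ω, Y N ω ^ 2 ∂P ≤ b N) : TendstoInMeasure P Y atTop 0 := by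
  rw [tendstoInMeasure_iff_measureReal_norm]
  intro ε hε
  have h0 : Tendsto (fun N ↦ b N / ε ^ 2) atTop (𝓝 0) := by simpa using hb.div_const (ε ^ 2)
  refine squeeze_zero' (Eventually.of_forall fun _ ↦ measureReal_nonneg) ?_ h0
  filter_upwards [hL, hY] with N h1 h2
  rw [le_div_iff₀' (by positivity)]
  refine le_trans ?_ ((mul_meas_ge_le_integral_of_nonneg (ae_of_all _ fun ω ↦ sq_nonneg (Y N ω))
    h1.integrable_sq (ε ^ 2)).trans h2)
  refine mul_le_mul_of_nonneg_left (measureReal_mono fun ω hω ↦ ?_) (by positivity)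
  simp only [Pi.zero_apply, sub_zero, Set.mem_ofPred_eq, Real.norm_eq_abs] at hω ⊢
  rw [← sq_abs (Y N ω)]
  exact pow_le_pow_left₀ hε.le hω 2

lemma TendstoInMeasure.add_zero_zero [IsProbabilityMeasure P] {Y Z : ℕ → Ω → ℝ}
    (hY : TendstoInMeasure P Y atTop 0) (hZ : TendstoInMeasure P Z atTop 0) :
    TendstoInMeasure P (fun N ω ↦ Y N ω + Z N ω) atTop 0 := by
  rw [tendstoInMeasure_iff_measureReal_norm] at *
  intro ε hε
  have h := (hY (ε / 2) (half_pos hε)).add (hZ (ε / 2) (half_pos hε))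
  rw [add_zero] at h
  refine squeeze_zero (fun _ ↦ measureReal_nonneg) (fun N ↦ ?_) h
  refine (measureReal_mono fun ω hω ↦ ?_).trans (measureReal_union_le _ _)
  simp only [Pi.zero_apply, sub_zero, Set.mem_ofPred_eq, Real.norm_eq_abs, Set.mem_union] at hω ⊢
  by_contra hn
  push Not at hn
  linarith [abs_add_le (Y N ω) (Z N ω)]

lemma TendstoInMeasure.const_mul_zero [IsProbabilityMeasure P] {Y : ℕ → Ω → ℝ}
    (hY : TendstoInMeasure P Y atTop 0) (c : ℝ) :
    TendstoInMeasure P (fun N ω ↦ c * Y N ω) atTop 0 := by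
  rw [tendstoInMeasure_iff_measureReal_norm] at *
  intro ε hε
  have hc : 0 < |c| + 1 := by positivity
  refine squeeze_zero (fun _ ↦ measureReal_nonneg) (fun N ↦ ?_) (hY (ε / (|c| + 1)) (by positivity))
  refine measureReal_mono fun ω hω ↦ ?_
  simp only [Pi.zero_apply, sub_zero, Set.mem_ofPred_eq, Real.norm_eq_abs, abs_mul] at hω ⊢
  rw [div_le_iff₀ hc]
  nlinarith [abs_nonneg (Y N ω)]

end VolTarget

/-! ### The three difference sums for abstract Gaussian increments -/

namespace VolTarget

variable {Ω : Type*} [MeasurableSpace Ω] {P : Measure Ω} [IsProbabilityMeasure P]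

lemma abs_sum_range_mul_le {N : ℕ} {x y : ℕ → ℝ} {b c : ℝ} (hx : ∀ k < N, |x k| ≤ b)
    (hy : ∀ k < N, |y k| ≤ c) (hb : 0 ≤ b) : |∑ k ∈ Finset.range N, x k * y k| ≤ N * (b * c) := by
  refine (Finset.abs_sum_le_sum_abs _ _).trans ?_
  refine (Finset.sum_le_card_nsmul _ _ (b * c) fun k hk ↦ ?_).trans (by simp)
  rw [abs_mul]
  exact mul_le_mul (hx k (Finset.mem_range.1 hk)) (hy k (Finset.mem_range.1 hk)) (abs_nonneg _) hb

/-- The differences between the drift, variance and martingale sums of the two indices, driven by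
independent Gaussian increments `ξ N k` of variance of order `g N ^ 40 = T / N`, tend to `0` in
probability. -/
theorem tendstoInMeasure_sums {lam v₀ slo shi A Bc T sb : ℝ} (hlam : lam ∈ Set.Ioo (0 : ℝ) 1)
    (hv₀ : 0 < v₀) (hslo : 0 < slo) (hA : 0 ≤ A) {g : ℕ → ℝ} (hg : ∀ N, 0 < N → 0 < g N)
    (hg0 : Tendsto g atTop (𝓝 0)) (hgT : ∀ N, 0 < N → N * g N ^ 40 = T) {ξ : ℕ → ℕ → Ω → ℝ}
    {a b c : ℕ → ℕ → ℝ} {vr : ℕ → ℕ → ℝ≥0} (hξ : ∀ N k, Measurable (ξ N k))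
    (hind : ∀ N, 0 < N → iIndepFun (ξ N) P)
    (hlaw : ∀ N, 0 < N → ∀ k, P.map (ξ N k) = gaussianReal 0 (vr N k))
    (hlo : ∀ N, 0 < N → ∀ k, slo ^ 2 * g N ^ 40 ≤ vr N k)
    (hhi : ∀ N, 0 < N → ∀ k, vr N k ≤ shi ^ 2 * g N ^ 40)
    (ha : ∀ N, ∀ k < N, |a N k| ≤ A * g N ^ 40) (hb : ∀ N, ∀ k < N, |b N k| ≤ Bc * g N ^ 40)
    (hc : ∀ N, ∀ k < N, |c N k| ≤ Bc * g N ^ 40) {V U : ℕ → ℕ → Ω → ℝ}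
    (hV : ∀ N k ω, V N k ω
      = ema lam v₀ (g N ^ 40) (fun j ↦ Real.exp (a N j + ξ N j ω) - 1) k)
    (hU : ∀ N k ω, U N k ω = ema lam v₀ (g N ^ 40) (fun j ↦ ξ N j ω) k) :
    TendstoInMeasure P (fun N ω ↦ ∑ k ∈ Finset.range N,
        (sb / √(V N k ω) - sb / √(U N k ω)) * b N k) atTop 0 ∧
      TendstoInMeasure P (fun N ω ↦ ∑ k ∈ Finset.range N,
        (sb ^ 2 / V N k ω - sb ^ 2 / U N k ω) * c N k) atTop 0 ∧
      TendstoInMeasure P (fun N ω ↦ ∑ k ∈ Finset.range N,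
        (sb / √(V N k ω) - sb / √(U N k ω)) * ξ N k ω) atTop 0 := by
  obtain ⟨K, g₀, hK, hg₀, hgood⟩ := exists_good_event (P := P) shi A T hlam hv₀ hslo hA
  have hev : ∀ᶠ N in atTop, 0 < N ∧ g N ≤ g₀ :=
    (eventually_gt_atTop 0).and ((hg0.eventually (gt_mem_nhds hg₀)).mono fun _ h ↦ h.le)
  -- The implication allows a single choice of `B` for all `N`, including those for which `g N` is
  -- not yet small.
  have hB : ∀ N, ∃ B : Set Ω, 0 < N ∧ g N ≤ g₀ → P.real B ≤ K * g N ^ 40 ∧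
      ∀ ω ∉ B, ∀ n < N, |(√(V N n ω))⁻¹ - (√(U N n ω))⁻¹| ≤ K * g N ^ 5 ∧
        |(V N n ω)⁻¹ - (U N n ω)⁻¹| ≤ K * g N ^ 4 := by
    intro N
    by_cases h : 0 < N ∧ g N ≤ g₀
    · obtain ⟨B, hB⟩ := hgood N (g N) (ξ N) (a N) (vr N) (hg N h.1) h.2 (hgT N h.1) (hξ N)
        (hind N h.1) (hlaw N h.1) (hlo N h.1) (hhi N h.1) (ha N)
      simp only [← hV, ← hU] at hB
      exact ⟨B, fun _ ↦ hB⟩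
    · exact ⟨∅, fun h' ↦ absurd h' h⟩
  choose B hB using hB
  have hpow (n : ℕ) (hn : n ≠ 0) (C : ℝ) : Tendsto (fun N ↦ C * g N ^ n) atTop (𝓝 0) := by
    simpa [hn] using (hg0.pow n).const_mul C
  have hq := hpow 40 (by norm_num) K
  have hBq : ∀ᶠ N in atTop, P.real (B N) ≤ K * g N ^ 40 := hev.mono fun N h ↦ (hB N h).1
  have hw1 : ∀ N, 0 < N ∧ g N ≤ g₀ → ∀ ω ∉ B N, ∀ k < N,
      |sb / √(V N k ω) - sb / √(U N k ω)| ≤ |sb| * K * g N ^ 5 := by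
    intro N h ω hω k hk
    rw [div_eq_mul_inv, div_eq_mul_inv, ← mul_sub, abs_mul, mul_assoc]
    exact mul_le_mul_of_nonneg_left ((hB N h).2 ω hω k hk).1 (abs_nonneg _)
  have hw2 : ∀ N, 0 < N ∧ g N ≤ g₀ → ∀ ω ∉ B N, ∀ k < N,
      |sb ^ 2 / V N k ω - sb ^ 2 / U N k ω| ≤ sb ^ 2 * K * g N ^ 4 := by
    intro N h ω hω k hk
    rw [div_eq_mul_inv, div_eq_mul_inv, ← mul_sub, abs_mul, mul_assoc, abs_of_nonneg (sq_nonneg sb)]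
    exact mul_le_mul_of_nonneg_left ((hB N h).2 ω hω k hk).2 (sq_nonneg _)
  refine ⟨?_, ?_, ?_⟩
  · refine tendstoInMeasure_zero_of_bound hq (hpow 5 (by norm_num) (|sb| * K * Bc * T)) hBq ?_
    filter_upwards [hev] with N h ω hω
    have := hg N h.1
    refine (abs_sum_range_mul_le (hw1 N h ω hω) (hb N) (by positivity)).trans (le_of_eq ?_)
    rw [← hgT N h.1]
    ring
  · refine tendstoInMeasure_zero_of_bound hq (hpow 4 (by norm_num) (sb ^ 2 * K * Bc * T)) hBq ?_
    filter_upwards [hev] with N h ω hω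
    have := hg N h.1
    refine (abs_sum_range_mul_le (hw2 N h ω hω) (hc N) (by positivity)).trans (le_of_eq ?_)
    rw [← hgT N h.1]
    ring
  · set ε : ℕ → ℝ := fun N ↦ |sb| * K * g N ^ 5 with hε
    -- The uniform bound on the weights holds only on the good event, and restricting to that event
    -- would destroy the dependence on the past. Clipping to `[-ε, ε]` keeps it, gives a bound
    -- everywhere, and changes nothing on the good event.
    set δ : ℕ → ℕ → Ω → ℝ := fun N k ω ↦
      max (-ε N) (min (ε N) (sb / √(V N k ω) - sb / √(U N k ω))) with hδ
    have hmart : ∀ N, 0 < N ∧ g N ≤ g₀ →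
        MemLp (fun ω ↦ ∑ k ∈ Finset.range N, δ N k ω * ξ N k ω) 2 P ∧
        ∫ ω, (∑ k ∈ Finset.range N, δ N k ω * ξ N k ω) ^ 2 ∂P
          ≤ N * (ε N ^ 2 * (shi ^ 2 * g N ^ 40)) := by
      intro N h
      have hε0 : 0 ≤ ε N := by
        have := hg N h.1
        positivity
      have hl (k : ℕ) : HasLaw (ξ N k) (gaussianReal 0 (vr N k)) P :=
        ⟨(hξ N k).aemeasurable, hlaw N h.1 k⟩
      have h0 (k : ℕ) : ∫ ω, ξ N k ω ∂P = 0 := by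
        rw [(hl k).integral_eq, integral_id_gaussianReal]
      refine (martingaleTransform_sq_le (hξ N) (hind N h.1)
        (fun k ↦ (hl k).hasGaussianLaw.memLp_two)
        h0 (fun k ↦ ?_) (fun k ↦ ?_) (fun k ω ↦ ?_) N).2
      · rw [← variance_of_integral_eq_zero (hξ N k).aemeasurable (h0 k), (hl k).variance_eq,
          variance_id_gaussianReal]
        exact hhi N h.1 k
      · have hVm : Measurable[past (ξ N) k] (V N k) := by
          rw [funext (hV N k)]
          exact @measurable_ema _ _ _ _ (past (ξ N) k) _ k fun j hj ↦
            Measurable.sub_const (Real.measurable_exp.comp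
              (Measurable.const_add (measurable_past (ξ N) hj) _)) 1
        have hUm : Measurable[past (ξ N) k] (U N k) := by
          rw [funext (hU N k)]
          exact @measurable_ema _ _ _ _ (past (ξ N) k) _ k fun j hj ↦ measurable_past (ξ N) hj
        have hf : Measurable fun p : ℝ × ℝ ↦ max (-ε N) (min (ε N) (sb / √p.1 - sb / √p.2)) := by
          fun_prop
        exact hf.comp (Measurable.prodMk hVm hUm)
      · exact abs_le.2 ⟨le_max_left _ _, max_le (by linarith) (min_le_left _ _)⟩
    have h1 : TendstoInMeasure P (fun N ω ↦ ∑ k ∈ Finset.range N, δ N k ω * ξ N k ω) atTop 0 := by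
      refine tendstoInMeasure_zero_of_sq_le (hpow 10 (by norm_num) ((|sb| * K) ^ 2 * shi ^ 2 * T))
        (hev.mono fun N h ↦ (hmart N h).1) (hev.mono fun N h ↦ (hmart N h).2.trans (le_of_eq ?_))
      rw [← hgT N h.1, hε]
      ring
    -- The clipped and the original sums coincide off `B N`, so the bound on the difference is `0`.
    have h2 : TendstoInMeasure P (fun N ω ↦ (∑ k ∈ Finset.range N,
        (sb / √(V N k ω) - sb / √(U N k ω)) * ξ N k ω)
          - ∑ k ∈ Finset.range N, δ N k ω * ξ N k ω) atTop 0 := by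
      refine tendstoInMeasure_zero_of_bound hq tendsto_const_nhds hBq (hev.mono fun N h ω hω ↦ ?_)
      rw [abs_nonpos_iff, sub_eq_zero]
      refine Finset.sum_congr rfl fun k hk ↦ ?_
      have := abs_le.1 (hw1 N h ω hω k (Finset.mem_range.1 hk))
      rw [hδ]
      simp only
      rw [min_eq_right this.2, max_eq_right this.1]
    simpa using TendstoInMeasure.add_zero_zero h1 h2

end VolTarget

namespace VolTarget

variable {Ω : Type*}

/-! ### Bounded coefficient functions -/

/-- Clip a measurable version to `[lo, hi]`. Bounds valid everywhere make the variance estimates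
hold on every window, even those beyond `T`. -/
lemma exists_measurable_bounded_version {f : ℝ → ℝ} {T lo hi : ℝ} (hT : 0 < T)
    (hf : AEStronglyMeasurable f (volume.restrict (Set.Ioo 0 T)))
    (hbd : ∀ᵐ t ∂(volume.restrict (Set.Ioo 0 T)), lo < f t ∧ f t < hi) :
    ∃ s : ℝ → ℝ, Measurable s ∧ (∀ x, lo ≤ s x ∧ s x ≤ hi) ∧
      ∀ᵐ t ∂(volume.restrict (Set.Ioc 0 T)), f t = s t := by
  -- Since `(0, T)` is not null, some point satisfies the bounds, which yields `lo ≤ hi`.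
  have hne : NeBot (ae (volume.restrict (Set.Ioo 0 T))) := by
    rw [ae_neBot, Ne, Measure.restrict_eq_zero]
    simp [hT]
  obtain ⟨t, ht⟩ := hbd.exists
  have hlohi : lo ≤ hi := (ht.1.trans ht.2).le
  refine ⟨fun x ↦ max lo (min hi (hf.mk f x)),
    measurable_const.max (measurable_const.min hf.stronglyMeasurable_mk.measurable),
    fun x ↦ ⟨le_max_left _ _, max_le hlohi (min_le_left _ _)⟩, ?_⟩
  rw [← Measure.restrict_congr_set Ioo_ae_eq_Ioc]
  filter_upwards [hf.ae_eq_mk, hbd] with x h1 h2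
  rw [← h1, min_eq_right h2.2.le, max_eq_right h2.1.le]

lemma exists_bound_of_memLp_top {f : ℝ → ℝ} {T : ℝ}
    (hf : MemLp f ∞ (volume.restrict (Set.Ioo 0 T))) :
    ∃ C, 0 ≤ C ∧ ∀ a b, 0 ≤ a → a ≤ b → b ≤ T →
      IntervalIntegrable f volume a b ∧ |∫ t in a..b, f t| ≤ C * (b - a) := by
  have hi : IntegrableOn f (Set.Ioc 0 T) := by
    rw [integrableOn_Ioc_iff_integrableOn_Ioo]
    exact hf.integrable le_top
  have hb : ∀ᵐ t ∂(volume.restrict (Set.Ioc 0 T)), ‖f t‖ ≤ (eLpNormEssSup f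
      (volume.restrict (Set.Ioo 0 T))).toReal := by
    rw [← Measure.restrict_congr_set Ioo_ae_eq_Ioc]
    have hlt : eLpNormEssSup f (volume.restrict (Set.Ioo 0 T)) < ∞ := by
      simpa using hf.eLpNorm_lt_top
    filter_upwards [ae_le_eLpNormEssSup (f := f) (μ := volume.restrict (Set.Ioo 0 T))] with t ht
    rw [← toReal_enorm]
    exact ENNReal.toReal_mono hlt.ne ht
  refine ⟨(eLpNormEssSup f (volume.restrict (Set.Ioo 0 T))).toReal, ENNReal.toReal_nonneg,
    fun a b ha hab hbT ↦ ⟨?_, ?_⟩⟩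
  · exact (intervalIntegrable_iff_integrableOn_Ioc_of_le hab).2
      (hi.mono_set (Set.Ioc_subset_Ioc ha hbT))
  · rw [intervalIntegral.integral_of_le hab]
    have := norm_setIntegral_le_of_norm_le_const_ae (μ := volume) (s := Set.Ioc a b) (by simp)
      (ae_restrict_of_ae_restrict_of_subset (Set.Ioc_subset_Ioc ha hbT) hb)
    simpa [hab] using this

lemma memLp_indicator_Ioc_of_bound {s : ℝ → ℝ} {C : ℝ} (hs : Measurable s) (hC : ∀ x, |s x| ≤ C)
    (a b : ℝ) : MemLp ((Set.Ioc a b).indicator s) 2 volume := by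
  rw [memLp_indicator_iff_restrict measurableSet_Ioc]
  exact MemLp.of_bound hs.aestronglyMeasurable C (ae_of_all _ hC)

lemma integral_indicator_sq_mem_Icc {s : ℝ → ℝ} {lo hi a b : ℝ} (hlo : 0 ≤ lo) (hab : a ≤ b)
    (hs : Measurable s) (hbd : ∀ x, lo ≤ s x ∧ s x ≤ hi) :
    lo ^ 2 * (b - a) ≤ ∫ x, (Set.Ioc a b).indicator s x ^ 2 ∧
      ∫ x, (Set.Ioc a b).indicator s x ^ 2 ≤ hi ^ 2 * (b - a) := by
  have habs (x : ℝ) : |s x| ≤ hi := by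
    rw [abs_of_nonneg (hlo.trans (hbd x).1)]
    exact (hbd x).2
  have hint : IntegrableOn (fun x ↦ s x ^ 2) (Set.Ioc a b) := by
    have := (memLp_indicator_iff_restrict measurableSet_Ioc).1
      (memLp_indicator_Ioc_of_bound hs habs a b)
    exact this.integrable_sq
  have e : ∫ x, (Set.Ioc a b).indicator s x ^ 2 = ∫ x in Set.Ioc a b, s x ^ 2 := by
    rw [← integral_indicator measurableSet_Ioc]
    congr 1
    ext x
    by_cases hx : x ∈ Set.Ioc a b <;> simp [hx]
  have hconst (c : ℝ) : ∫ _ in Set.Ioc a b, c ^ 2 = c ^ 2 * (b - a) := by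
    simp [hab, mul_comm]
  rw [e, ← hconst lo, ← hconst hi]
  constructor
  · exact setIntegral_mono_on (by simp) hint measurableSet_Ioc
      fun x _ ↦ pow_le_pow_left₀ hlo (hbd x).1 2
  · exact setIntegral_mono_on hint (by simp) measurableSet_Ioc
      fun x _ ↦ pow_le_pow_left₀ (hlo.trans (hbd x).1) (hbd x).2 2

/-! ### The observation times -/

namespace Model

variable {M : Model}

lemma time_succ_sub (N n : ℕ) : M.time N (n + 1) - M.time N n = M.dt N := by
  simp only [time]; push_cast; ring

lemma natCast_mul_dt {N : ℕ} (hN : 0 < N) : N * M.dt N = M.T := by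
  have : (N : ℝ) ≠ 0 := by positivity
  simp only [dt]; field_simp

lemma dt_nonneg (hT : 0 < M.T) (N : ℕ) : 0 ≤ M.dt N := div_nonneg hT.le (Nat.cast_nonneg N)

lemma time_mono (hT : 0 < M.T) (N : ℕ) : Monotone (M.time N) := fun _ _ h ↦
  mul_le_mul_of_nonneg_right (by exact_mod_cast h) (dt_nonneg hT N)

lemma time_nonneg (hT : 0 < M.T) (N n : ℕ) : 0 ≤ M.time N n :=
  mul_nonneg (Nat.cast_nonneg n) (dt_nonneg hT N)

lemma time_le (hT : 0 < M.T) {N n : ℕ} (h : n ≤ N) : M.time N n ≤ M.T := by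
  -- For `N = 0` division by zero makes the time step `0`, so the only time is `0`.
  rcases Nat.eq_zero_or_pos N with rfl | hN
  · obtain rfl : n = 0 := by omega
    simpa [time] using hT.le
  · exact (time_mono hT N h).trans (natCast_mul_dt hN).le

end Model

/-! ### Measurability -/

variable [MeasurableSpace Ω] {P : Measure Ω} {W : ℝ≥0 → Ω → ℝ}

lemma aemeasurable_wienerIntegral (f : ℝ → ℝ) (a b : ℝ) :
    AEMeasurable (wienerIntegral W P f a b) P := by
  unfold wienerIntegral
  split_ifs with h
  · exact h.choose_spec.memLp.aestronglyMeasurable.aemeasurable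
  · exact aemeasurable_const

namespace Model

variable {M : Model}

lemma aemeasurable_S (t : ℝ) : AEMeasurable (M.S W P t) P :=
  (Real.measurable_exp.comp_aemeasurable
    ((aemeasurable_wienerIntegral M.σ 0 t).const_add _)).const_mul _

lemma aemeasurable_v (N n : ℕ) : AEMeasurable (M.v W P N n) P := by
  induction n with
  | zero => exact aemeasurable_const
  | succ n ih =>
    exact (ih.const_mul _).add (((((aemeasurable_S _).div (aemeasurable_S _)).sub_const _).pow_const
      2).const_mul _)

lemma aemeasurable_u (N n : ℕ) : AEMeasurable (M.u W P N n) P := by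
  induction n with
  | zero => exact aemeasurable_const
  | succ n ih =>
    exact (ih.const_mul _).add (((aemeasurable_wienerIntegral _ _ _).pow_const 2).const_mul _)

lemma aemeasurable_remainder (N : ℕ) : AEMeasurable (M.remainder W P N) P := by
  have hv (k) := aemeasurable_v (M := M) (W := W) (P := P) N k
  have hu (k) := aemeasurable_u (M := M) (W := W) (P := P) N k
  have h1 (k : ℕ) : AEMeasurable
      (fun ω ↦ M.sbar / √(M.v W P N k ω) - M.sbar / √(M.u W P N k ω)) P :=
    ((hv k).sqrt.const_div _).sub ((hu k).sqrt.const_div _)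
  have h2 (k : ℕ) : AEMeasurable
      (fun ω ↦ M.sbar ^ 2 / M.v W P N k ω - M.sbar ^ 2 / M.u W P N k ω) P :=
    ((hv k).const_div _).sub ((hu k).const_div _)
  exact ((Finset.aemeasurable_fun_sum _ fun k _ ↦ (h1 k).mul_const _).add
    ((Finset.aemeasurable_fun_sum _ fun k _ ↦ (h2 k).mul_const _).const_mul _)).add
    (Finset.aemeasurable_fun_sum _ fun k _ ↦ (h1 k).mul (aemeasurable_wienerIntegral _ _ _))

/-! ### The index -/

lemma integral_drift {a b : ℝ} (hr : IntervalIntegrable M.r volume a b)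
    (hρ : IntervalIntegrable M.ρ volume a b)
    (hσ : IntervalIntegrable (fun t ↦ M.σ t ^ 2) volume a b) (w : ℝ) :
    ∫ t in a..b, ((1 - w) * M.r t + w * M.ρ t - w ^ 2 * M.σ t ^ 2 / 2)
      = (∫ t in a..b, M.r t) + w * (∫ t in a..b, (M.ρ t - M.r t))
        - w ^ 2 / 2 * ∫ t in a..b, M.σ t ^ 2 := by
  have e (t : ℝ) : (1 - w) * M.r t + w * M.ρ t - w ^ 2 * M.σ t ^ 2 / 2
      = M.r t + w * (M.ρ t - M.r t) - w ^ 2 / 2 * M.σ t ^ 2 := by ring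
  simp_rw [e]
  rw [intervalIntegral.integral_sub (hr.add ((hρ.sub hr).const_mul w)) (hσ.const_mul _),
    intervalIntegral.integral_add hr ((hρ.sub hr).const_mul w),
    intervalIntegral.integral_const_mul, intervalIntegral.integral_const_mul]

lemma index_pos (hI₀ : 0 < M.I₀) (N : ℕ) (q : ℕ → Ω → ℝ) (n : ℕ) (ω : Ω) :
    0 < M.index W P N q n ω := by
  induction n with
  | zero => exact hI₀
  | succ n ih => exact mul_pos ih (Real.exp_pos _)

/-- All the coefficients of the index are integrable on the subintervals of `[0, T]`. -/
structure IntegrableCoeffs (M : Model) : Prop where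
  r : ∀ a b, 0 ≤ a → a ≤ b → b ≤ M.T → IntervalIntegrable M.r volume a b
  ρ : ∀ a b, 0 ≤ a → a ≤ b → b ≤ M.T → IntervalIntegrable M.ρ volume a b
  sq : ∀ a b, 0 ≤ a → a ≤ b → b ≤ M.T → IntervalIntegrable (fun t ↦ M.σ t ^ 2) volume a b

lemma IntegrableCoeffs.integral_drift (hM : M.IntegrableCoeffs) (hT : 0 < M.T) {N k : ℕ}
    (hk : k < N) (w : ℝ) :
    ∫ t in (M.time N k)..(M.time N (k + 1)),
        ((1 - w) * M.r t + w * M.ρ t - w ^ 2 * M.σ t ^ 2 / 2)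
      = (∫ t in (M.time N k)..(M.time N (k + 1)), M.r t)
        + w * (∫ t in (M.time N k)..(M.time N (k + 1)), (M.ρ t - M.r t))
        - w ^ 2 / 2 * ∫ t in (M.time N k)..(M.time N (k + 1)), M.σ t ^ 2 := by
  have h1 := time_nonneg hT N k
  have h2 := time_mono hT N k.le_succ
  have h3 := time_le hT (N := N) (n := k + 1) hk
  exact Model.integral_drift (hM.r _ _ h1 h2 h3) (hM.ρ _ _ h1 h2 h3) (hM.sq _ _ h1 h2 h3) w

/-- Splitting the drift integral exhibits it as a polynomial in the leverage, so its measurability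
in `ω` is clear. The split needs integrability, hence windows inside `[0, T]`. -/
lemma aemeasurable_index (hM : M.IntegrableCoeffs) (hT : 0 < M.T) {N : ℕ} {q : ℕ → Ω → ℝ}
    (hq : ∀ k, AEMeasurable (q k) P) {n : ℕ} (hn : n ≤ N) :
    AEMeasurable (M.index W P N q n) P := by
  induction n with
  | zero => exact aemeasurable_const
  | succ n ih =>
    have hw : AEMeasurable (fun ω ↦ M.leverage (q n ω)) P := (hq n).sqrt.const_div _
    refine AEMeasurable.congr (f := fun ω ↦ M.index W P N q n ω * Real.exp
      ((∫ t in (M.time N n)..(M.time N (n + 1)), M.r t)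
        + M.leverage (q n ω) * (∫ t in (M.time N n)..(M.time N (n + 1)), (M.ρ t - M.r t))
        - M.leverage (q n ω) ^ 2 / 2 * (∫ t in (M.time N n)..(M.time N (n + 1)), M.σ t ^ 2)
        + M.leverage (q n ω) * wienerIntegral W P M.σ (M.time N n) (M.time N (n + 1)) ω))
      ?_ (ae_of_all _ fun ω ↦ ?_)
    · exact (ih (by omega)).mul (Real.measurable_exp.comp_aemeasurable
        ((((hw.mul_const _).const_add _).sub (((hw.pow_const 2).div_const 2).mul_const _)).add
          (hw.mul (aemeasurable_wienerIntegral _ _ _))))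
    · simp only [index]
      rw [hM.integral_drift hT hn]

lemma log_index (hM : M.IntegrableCoeffs) (hT : 0 < M.T) (hI₀ : 0 < M.I₀) {N : ℕ}
    {q : ℕ → Ω → ℝ} {n : ℕ} (hn : n ≤ N) {ω : Ω} (hq : ∀ k < n, 0 < q k ω) :
    Real.log (M.index W P N q n ω) = Real.log M.I₀ + ∑ k ∈ Finset.range n,
      ((∫ t in (M.time N k)..(M.time N (k + 1)), M.r t)
        + M.sbar / √(q k ω) * (∫ t in (M.time N k)..(M.time N (k + 1)), (M.ρ t - M.r t))
        - 1 / 2 * (M.sbar ^ 2 / q k ω * ∫ t in (M.time N k)..(M.time N (k + 1)), M.σ t ^ 2)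
        + M.sbar / √(q k ω) *
          wienerIntegral W P M.σ (M.time N k) (M.time N (k + 1)) ω) := by
  induction n with
  | zero => simp [index]
  | succ n ih =>
    rw [Finset.sum_range_succ, ← add_assoc, ← ih (by omega) fun k hk ↦ hq k (by omega)]
    simp only [index]
    rw [Real.log_mul (index_pos hI₀ N q n ω).ne' (Real.exp_ne_zero _), Real.log_exp,
      hM.integral_drift hT hn]
    have : M.leverage (q n ω) ^ 2 = M.sbar ^ 2 / q n ω := by
      rw [leverage, div_pow, Real.sq_sqrt (hq n (by omega)).le]
    rw [this]
    simp only [leverage]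
    ring

lemma log_index_sub_log_index (hM : M.IntegrableCoeffs) (hT : 0 < M.T) (hI₀ : 0 < M.I₀) {N : ℕ}
    {q p : ℕ → Ω → ℝ} {ω : Ω} (hq : ∀ k < N, 0 < q k ω) (hp : ∀ k < N, 0 < p k ω) :
    Real.log (M.index W P N q N ω) - Real.log (M.index W P N p N ω)
      = (∑ k ∈ Finset.range N, (M.sbar / √(q k ω) - M.sbar / √(p k ω)) *
          ∫ t in (M.time N k)..(M.time N (k + 1)), (M.ρ t - M.r t))
        + -(1 / 2) * (∑ k ∈ Finset.range N, (M.sbar ^ 2 / q k ω - M.sbar ^ 2 / p k ω) *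
          ∫ t in (M.time N k)..(M.time N (k + 1)), M.σ t ^ 2)
        + ∑ k ∈ Finset.range N, (M.sbar / √(q k ω) - M.sbar / √(p k ω)) *
          wienerIntegral W P M.σ (M.time N k) (M.time N (k + 1)) ω := by
  rw [log_index hM hT hI₀ le_rfl hq, log_index hM hT hI₀ le_rfl hp, add_sub_add_left_eq_sub,
    ← Finset.sum_sub_distrib, Finset.mul_sum, ← Finset.sum_add_distrib, ← Finset.sum_add_distrib]
  exact Finset.sum_congr rfl fun k _ ↦ by ring

end Model

/-! ### Slutsky's theorem for logarithms -/

/-- Write `Z = Y * exp (-(log Y - log Z))` and apply Slutsky's theorem; no tightness of the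
logarithms is needed. -/
lemma TendstoLaw.of_log_sub_log [IsProbabilityMeasure P] {Y Z : ℕ → Ω → ℝ}
    (hY0 : ∀ N ω, 0 < Y N ω) (hZ0 : ∀ N ω, 0 < Z N ω) (hZ : ∀ N, AEMeasurable (Z N) P)
    (h : TendstoInMeasure P (fun N ω ↦ Real.log (Y N ω) - Real.log (Z N ω)) atTop 0)
    {ν : ProbabilityMeasure ℝ} (hY : TendstoLaw P Y ν) : TendstoLaw P Z ν := by
  have hcont : Continuous fun p : ℝ × ℝ ↦ p.1 * Real.exp (-p.2) := by fun_prop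
  have hm (N : ℕ) : AEMeasurable (fun ω ↦ Real.log (Y N ω) - Real.log (Z N ω)) P :=
    (Real.measurable_log.comp_aemeasurable (hY.forall_aemeasurable N)).sub
      (Real.measurable_log.comp_aemeasurable (hZ N))
  have := hY.continuous_comp_prodMk_of_tendstoInMeasure_const (c := (0 : ℝ)) hcont h hm
  refine this.congr (fun N ↦ ae_of_all _ fun ω ↦ ?_) (ae_of_all _ fun x ↦ by simp)
  simp only [neg_sub]
  rw [Real.exp_sub, Real.exp_log (hY0 N ω), Real.exp_log (hZ0 N ω),
    mul_div_cancel₀ _ (hY0 N ω).ne']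

end VolTarget

/-! ### Identification of the model with the abstract Gaussian setting -/

namespace VolTarget

variable {Ω : Type*} [MeasurableSpace Ω] {P : Measure Ω} {W : ℝ≥0 → Ω → ℝ} {M : Model}

namespace Model

lemma v_eq_ema {N : ℕ} {x : ℕ → ℝ} {ω : Ω} {n : ℕ} (hn : n ≤ N)
    (hx : ∀ k < N, M.S W P (M.time N (k + 1)) ω / M.S W P (M.time N k) ω - 1 = x k) :
    M.v W P N n ω = ema M.lam M.v₀ (M.dt N) x n := by
  induction n with
  | zero => rfl
  | succ n ih => rw [v, ema, ih (by omega), hx n (by omega)]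

lemma u_eq_ema {N : ℕ} {x : ℕ → ℝ} {ω : Ω} {n : ℕ} (hn : n ≤ N)
    (hx : ∀ k < N, wienerIntegral W P M.σ (M.time N k) (M.time N (k + 1)) ω = x k) :
    M.u W P N n ω = ema M.lam M.v₀ (M.dt N) x n := by
  induction n with
  | zero => rfl
  | succ n ih => rw [u, ema, ih (by omega), hx n (by omega)]

/-- The return over a window is `exp (a + ξ) - 1` with deterministic `a`, the form required by
`exists_good_event`. -/
lemma S_div_S (hS₀ : 0 < M.S₀) {s t x : ℝ} {ω : Ω}
    (hs : IntervalIntegrable (fun x ↦ M.ρ x - M.σ x ^ 2 / 2) volume 0 s)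
    (hst : IntervalIntegrable (fun x ↦ M.ρ x - M.σ x ^ 2 / 2) volume s t)
    (hx : wienerIntegral W P M.σ 0 t ω = wienerIntegral W P M.σ 0 s ω + x) :
    M.S W P t ω / M.S W P s ω = Real.exp ((∫ y in s..t, (M.ρ y - M.σ y ^ 2 / 2)) + x) := by
  rw [S, S, hx, mul_div_mul_left _ _ hS₀.ne', ← Real.exp_sub,
    ← intervalIntegral.integral_add_adjacent_intervals hs hst]
  congr 1
  ring

/-- The Gaussian increments of the volatility-weighted Brownian motion over the observation
windows, for a version `s` of the volatility that is bounded on the whole line. -/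
noncomputable def increment (M : Model) (W : ℝ≥0 → Ω → ℝ) (P : Measure Ω) (s : ℝ → ℝ)
    (N k : ℕ) : Ω → ℝ :=
  (aemeasurable_wienerIntegral (P := P) (W := W) s (M.time N k) (M.time N (k + 1))).mk _

lemma measurable_increment (s : ℝ → ℝ) (N k : ℕ) : Measurable (M.increment W P s N k) :=
  AEMeasurable.measurable_mk _

lemma increment_ae_eq (s : ℝ → ℝ) (N k : ℕ) :
    M.increment W P s N k =ᵐ[P] wienerIntegral W P s (M.time N k) (M.time N (k + 1)) :=
  (AEMeasurable.ae_eq_mk _).symm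

variable {s : ℝ → ℝ} {C : ℝ}

lemma isWienerIntegral_increment (hW : IsPreBrownianReal W P) (hT : 0 < M.T) (hs : Measurable s)
    (hC : ∀ x, |s x| ≤ C) (N k : ℕ) :
    IsWienerIntegral W P ((Set.Ioc (M.time N k) (M.time N (k + 1))).indicator s)
      (wienerIntegral W P s (M.time N k) (M.time N (k + 1))) :=
  isWienerIntegral_wienerIntegral hW (time_nonneg hT N k) (memLp_indicator_Ioc_of_bound hs hC _ _)

lemma map_increment (hW : IsPreBrownianReal W P) (hT : 0 < M.T) (hs : Measurable s)
    (hC : ∀ x, |s x| ≤ C) (N k : ℕ) :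
    P.map (M.increment W P s N k) = gaussianReal 0
      (∫ x, (Set.Ioc (M.time N k) (M.time N (k + 1))).indicator s x ^ 2).toNNReal := by
  rw [Measure.map_congr (increment_ae_eq s N k)]
  exact (isWienerIntegral_increment hW hT hs hC N k).map_eq hW
    (memLp_indicator_Ioc_of_bound hs hC _ _)

lemma iIndepFun_increment (hW : IsPreBrownianReal W P) (hT : 0 < M.T) (hs : Measurable s)
    (hC : ∀ x, |s x| ≤ C) (N : ℕ) : iIndepFun (M.increment W P s N) P := by
  refine iIndepFun.congr (fun k ↦ (increment_ae_eq s N k).symm) ?_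
  refine iIndepFun_of_isWienerIntegral hW (fun k ↦ memLp_indicator_Ioc_of_bound hs hC _ _)
    (isWienerIntegral_increment hW hT hs hC N) fun i j hij x ↦ ?_
  have hd : Disjoint (Set.Ioc (M.time N i) (M.time N (i + 1)))
      (Set.Ioc (M.time N j) (M.time N (j + 1))) := by
    rcases lt_or_gt_of_ne hij with h | h
    · exact Set.Ioc_disjoint_Ioc_of_le (time_mono hT N h)
    · exact (Set.Ioc_disjoint_Ioc_of_le (time_mono hT N h)).symm
  by_cases hx : x ∈ Set.Ioc (M.time N i) (M.time N (i + 1))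
  · rw [Set.indicator_of_notMem (Set.disjoint_left.1 hd hx), mul_zero]
  · rw [Set.indicator_of_notMem hx, zero_mul]

lemma wienerIntegral_congr_of_le {f : ℝ → ℝ}
    (hf : ∀ᵐ t ∂(volume.restrict (Set.Ioc 0 M.T)), f t = s t) {a b : ℝ} (ha : 0 ≤ a)
    (hb : b ≤ M.T) : wienerIntegral W P f a b = wienerIntegral W P s a b := by
  refine wienerIntegral_congr ?_
  filter_upwards [(ae_restrict_iff' measurableSet_Ioc).1 hf] with x hx
  by_cases h : x ∈ Set.Ioc a b
  · rw [Set.indicator_of_mem h, Set.indicator_of_mem h, hx ⟨ha.trans_lt h.1, h.2.trans hb⟩]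
  · rw [Set.indicator_of_notMem h, Set.indicator_of_notMem h]

/-- Each Wiener integral is a separate choice up to a null set, so additivity holds only almost
surely. Countably many windows leave one common null set, off which the recursions can be compared
path by path. -/
lemma ae_wienerIntegral_eq_increment (hW : IsPreBrownianReal W P) (hT : 0 < M.T)
    (hs : Measurable s) (hC : ∀ x, |s x| ≤ C)
    (hσ : ∀ᵐ t ∂(volume.restrict (Set.Ioc 0 M.T)), M.σ t = s t) :
    ∀ᵐ ω ∂P, ∀ N, ∀ k < N,
      wienerIntegral W P M.σ (M.time N k) (M.time N (k + 1)) ω = M.increment W P s N k ω ∧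
      wienerIntegral W P M.σ 0 (M.time N (k + 1)) ω
        = wienerIntegral W P M.σ 0 (M.time N k) ω + M.increment W P s N k ω := by
  rw [ae_all_iff]
  intro N
  rw [ae_all_iff]
  intro k
  filter_upwards [increment_ae_eq (M := M) (W := W) (P := P) s N k,
    wienerIntegral_add_adjacent hW le_rfl (time_nonneg hT N k) (time_mono hT N k.le_succ)
      (memLp_indicator_Ioc_of_bound hs hC _ _)] with ω h1 h2 hk
  have hkT : M.time N (k + 1) ≤ M.T := time_le hT hk
  have hkT' : M.time N k ≤ M.T := time_le hT hk.le
  rw [wienerIntegral_congr_of_le hσ (time_nonneg hT N k) hkT,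
    wienerIntegral_congr_of_le hσ le_rfl hkT, wienerIntegral_congr_of_le hσ le_rfl hkT', h1]
  exact ⟨rfl, h2⟩

end Model

end VolTarget

/-! ### The main theorem -/

open VolTarget VolTarget.Model in
theorem mainTheorem5 {Ω : Type*} [MeasurableSpace Ω] (P : Measure Ω) [IsProbabilityMeasure P]
    (W : ℝ≥0 → Ω → ℝ) (hW : IsBrownianReal W P) (M : VolTarget.Model)
    (hT : 0 < M.T) (hS₀ : 0 < M.S₀) (hI₀ : 0 < M.I₀) (hv₀ : 0 < M.v₀)
    (hlam : M.lam ∈ Set.Ioo (0 : ℝ) 1)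
    (hr : MemLp M.r ∞ (volume.restrict (Set.Ioo 0 M.T)))
    (hρ : MemLp M.ρ ∞ (volume.restrict (Set.Ioo 0 M.T)))
    (hσ : MemLp M.σ ∞ (volume.restrict (Set.Ioo 0 M.T)))
    (σlo σhi : ℝ) (hσlo : 0 < σlo)
    (hσbd : ∀ᵐ t ∂(volume.restrict (Set.Ioo 0 M.T)), σlo < M.σ t ∧ M.σ t < σhi) :
    TendstoInDistribution (fun (N : ℕ) ω ↦ Real.log (M.I W P N ω) - Real.log (M.X W P N ω)) atTop
        (fun _ : Ω ↦ (0 : ℝ)) (fun _ ↦ P) P ∧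
      TendstoInDistribution (fun (N : ℕ) ω ↦ M.remainder W P N ω) atTop
        (fun _ : Ω ↦ (0 : ℝ)) (fun _ ↦ P) P ∧
      ((∃ ν, VolTarget.TendstoLaw P (M.I W P) ν) ↔ ∃ ν, VolTarget.TendstoLaw P (M.X W P) ν) ∧
      ∀ ν, VolTarget.TendstoLaw P (M.I W P) ν ↔ VolTarget.TendstoLaw P (M.X W P) ν := by
  have hB := hW.toIsPreBrownianReal
  obtain ⟨s, hs, hsbd, hσs⟩ := exists_measurable_bounded_version hT hσ.aestronglyMeasurable hσbd
  have hsC (x : ℝ) : |s x| ≤ σhi := by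
    rw [abs_of_nonneg (hσlo.le.trans (hsbd x).1)]
    exact (hsbd x).2
  have hσ2 : MemLp (fun t ↦ M.σ t ^ 2) ∞ (volume.restrict (Set.Ioo 0 M.T)) := by
    simp_rw [sq]
    exact hσ.mul hσ
  obtain ⟨Cr, -, hCr⟩ := exists_bound_of_memLp_top hr
  obtain ⟨Cρ, -, hCρ⟩ := exists_bound_of_memLp_top hρ
  obtain ⟨Cd, -, hCd⟩ := exists_bound_of_memLp_top (hρ.sub hr)
  obtain ⟨Cs, -, hCs⟩ := exists_bound_of_memLp_top hσ2
  obtain ⟨A, hA0, hCA⟩ := exists_bound_of_memLp_top (f := fun t ↦ M.ρ t - M.σ t ^ 2 / 2) (by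
    simp_rw [div_eq_inv_mul]
    exact hρ.sub (hσ2.const_mul _))
  have hM : M.IntegrableCoeffs := ⟨fun a b h1 h2 h3 ↦ (hCr a b h1 h2 h3).1,
    fun a b h1 h2 h3 ↦ (hCρ a b h1 h2 h3).1, fun a b h1 h2 h3 ↦ (hCs a b h1 h2 h3).1⟩
  -- The root that turns every scale into an integer power of `g`.
  set g : ℕ → ℝ := fun N ↦ M.dt N ^ ((40 : ℕ) : ℝ)⁻¹
  have hg40 (N : ℕ) : g N ^ 40 = M.dt N := Real.rpow_inv_natCast_pow (dt_nonneg hT N) (by norm_num)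
  have hg0 : Tendsto g atTop (𝓝 0) := by
    have h1 : Tendsto M.dt atTop (𝓝 0) := tendsto_const_div_atTop_nhds_zero_nat M.T
    have h2 := h1.rpow_const (p := ((40 : ℕ) : ℝ)⁻¹) (Or.inr (by positivity))
    rwa [Real.zero_rpow (by norm_num)] at h2
  have hgpos (N : ℕ) (hN : 0 < N) : 0 < g N :=
    Real.rpow_pos_of_pos (div_pos hT (by exact_mod_cast hN)) _
  have hstep {C : ℝ} {f : ℝ → ℝ} (hf : ∀ a b, 0 ≤ a → a ≤ b → b ≤ M.T →
      IntervalIntegrable f volume a b ∧ |∫ t in a..b, f t| ≤ C * (b - a)) (N k : ℕ) (hk : k < N) :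
      |∫ t in (M.time N k)..(M.time N (k + 1)), f t| ≤ C * g N ^ 40 := by
    have := (hf _ _ (time_nonneg hT N k) (time_mono hT N k.le_succ) (time_le hT hk)).2
    rwa [time_succ_sub, ← hg40] at this
  have hvar (N k : ℕ) := integral_indicator_sq_mem_Icc hσlo.le (time_mono hT N k.le_succ) hs hsbd
  simp only [Nat.succ_eq_add_one, time_succ_sub, ← hg40] at hvar
  have hnn (N k : ℕ) : 0 ≤ ∫ x, (Set.Ioc (M.time N k) (M.time N (k + 1))).indicator s x ^ 2 :=
    integral_nonneg fun x ↦ sq_nonneg _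
  set ξ := M.increment W P s
  set a : ℕ → ℕ → ℝ := fun N k ↦
    ∫ t in (M.time N k)..(M.time N (k + 1)), (M.ρ t - M.σ t ^ 2 / 2)
  obtain ⟨h1, h2, h3⟩ := tendstoInMeasure_sums (P := P) (T := M.T) (sb := M.sbar) (shi := σhi)
    (Bc := max Cd Cs) (ξ := ξ) (a := a)
    (b := fun N k ↦ ∫ t in (M.time N k)..(M.time N (k + 1)), (M.ρ t - M.r t))
    (c := fun N k ↦ ∫ t in (M.time N k)..(M.time N (k + 1)), M.σ t ^ 2)
    (vr := fun N k ↦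
      (∫ x, (Set.Ioc (M.time N k) (M.time N (k + 1))).indicator s x ^ 2).toNNReal)
    hlam hv₀ hσlo hA0 hgpos hg0 (fun N hN ↦ by rw [hg40, natCast_mul_dt hN])
    (fun N k ↦ measurable_increment s N k) (fun N _ ↦ iIndepFun_increment hB hT hs hsC N)
    (fun N _ k ↦ map_increment hB hT hs hsC N k)
    (fun N _ k ↦ by rw [Real.coe_toNNReal _ (hnn N k)]; exact (hvar N k).1)
    (fun N _ k ↦ by rw [Real.coe_toNNReal _ (hnn N k)]; exact (hvar N k).2)
    (hstep hCA)
    (fun N k hk ↦ (hstep hCd N k hk).trans (mul_le_mul_of_nonneg_right (le_max_left _ _)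
      (pow_nonneg (hgpos N (by omega)).le _)))
    (fun N k hk ↦ (hstep hCs N k hk).trans (mul_le_mul_of_nonneg_right (le_max_right _ _)
      (pow_nonneg (hgpos N (by omega)).le _)))
    (V := fun N k ω ↦ ema M.lam M.v₀ (g N ^ 40) (fun j ↦ Real.exp (a N j + ξ N j ω) - 1) k)
    (U := fun N k ω ↦ ema M.lam M.v₀ (g N ^ 40) (fun j ↦ ξ N j ω) k)
    (fun _ _ _ ↦ rfl) (fun _ _ _ ↦ rfl)
  have hae : ∀ᵐ ω ∂P, ∀ N, ∀ k < N,
      wienerIntegral W P M.σ (M.time N k) (M.time N (k + 1)) ω = ξ N k ω ∧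
      M.v W P N k ω
        = ema M.lam M.v₀ (g N ^ 40) (fun j ↦ Real.exp (a N j + ξ N j ω) - 1) k ∧
      M.u W P N k ω = ema M.lam M.v₀ (g N ^ 40) (fun j ↦ ξ N j ω) k := by
    filter_upwards [ae_wienerIntegral_eq_increment hB hT hs hsC hσs] with ω hω N k hk
    refine ⟨(hω N k hk).1, ?_, ?_⟩
    · rw [hg40]
      refine v_eq_ema hk.le fun j hj ↦ ?_
      rw [S_div_S hS₀ (hCA _ _ le_rfl (time_nonneg hT N j) (time_le hT hj.le)).1
        (hCA _ _ (time_nonneg hT N j) (time_mono hT N j.le_succ) (time_le hT hj)).1 (hω N j hj).2]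
    · rw [hg40]
      exact u_eq_ema hk.le fun j hj ↦ (hω N j hj).1
  have hIm (N : ℕ) : AEMeasurable (M.I W P N) P :=
    aemeasurable_index hM hT (aemeasurable_v N) le_rfl
  have hXm (N : ℕ) : AEMeasurable (M.X W P N) P :=
    aemeasurable_index hM hT (aemeasurable_u N) le_rfl
  have hI0 (N : ℕ) (ω : Ω) : 0 < M.I W P N ω := index_pos hI₀ N _ N ω
  have hX0 (N : ℕ) (ω : Ω) : 0 < M.X W P N ω := index_pos hI₀ N _ N ω
  have hlog : TendstoInMeasure P
      (fun N ω ↦ Real.log (M.I W P N ω) - Real.log (M.X W P N ω)) atTop 0 := by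
    refine (TendstoInMeasure.add_zero_zero
      (TendstoInMeasure.add_zero_zero h1 (TendstoInMeasure.const_mul_zero h2 (-(1 / 2))))
      h3).congr_left fun N ↦ ?_
    filter_upwards [hae] with ω hω
    -- With `N = 0` both indices equal the initial value. Otherwise the time step is positive, as
    -- positivity of the averages requires.
    rcases Nat.eq_zero_or_pos N with rfl | hN
    · simp [Model.I, Model.X, Model.index]
    have hh : 0 < g N ^ 40 := pow_pos (hgpos N hN) _
    rw [Model.I, Model.X, log_index_sub_log_index hM hT hI₀
      (fun k hk ↦ by rw [(hω N k hk).2.1]; exact ema_pos hlam hv₀ hh k)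
      (fun k hk ↦ by rw [(hω N k hk).2.2]; exact ema_pos hlam hv₀ hh k)]
    congr 1
    · congr 1
      · exact Finset.sum_congr rfl fun k hk ↦ by
          obtain ⟨-, e2, e3⟩ := hω N k (Finset.mem_range.1 hk)
          rw [e2, e3]
      · congr 1
        exact Finset.sum_congr rfl fun k hk ↦ by
          obtain ⟨-, e2, e3⟩ := hω N k (Finset.mem_range.1 hk)
          rw [e2, e3]
    · exact Finset.sum_congr rfl fun k hk ↦ by
        obtain ⟨e1, e2, e3⟩ := hω N k (Finset.mem_range.1 hk)
        rw [e1, e2, e3]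
  -- The variance sum enters here with `1 / 2`, but with `-(1 / 2)` in the difference of logarithms.
  -- Each sum vanishes separately, so the sign is immaterial.
  have hrem : TendstoInMeasure P (fun N ω ↦ M.remainder W P N ω) atTop 0 := by
    refine (TendstoInMeasure.add_zero_zero
      (TendstoInMeasure.add_zero_zero h1 (TendstoInMeasure.const_mul_zero h2 (1 / 2)))
      h3).congr_left fun N ↦ ?_
    filter_upwards [hae] with ω hω
    rw [Model.remainder]
    congr 1
    · congr 1
      · exact Finset.sum_congr rfl fun k hk ↦ by
          obtain ⟨-, e2, e3⟩ := hω N k (Finset.mem_range.1 hk)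
          rw [e2, e3]
      · congr 1
        exact Finset.sum_congr rfl fun k hk ↦ by
          obtain ⟨-, e2, e3⟩ := hω N k (Finset.mem_range.1 hk)
          rw [e2, e3]
    · exact Finset.sum_congr rfl fun k hk ↦ by
        obtain ⟨e1, e2, e3⟩ := hω N k (Finset.mem_range.1 hk)
        rw [e1, e2, e3]
  have hlog' : TendstoInMeasure P
      (fun N ω ↦ Real.log (M.X W P N ω) - Real.log (M.I W P N ω)) atTop 0 := by
    simpa using TendstoInMeasure.const_mul_zero hlog (-1)
  have hiff (ν : ProbabilityMeasure ℝ) : TendstoLaw P (M.I W P) ν ↔ TendstoLaw P (M.X W P) ν :=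
    ⟨TendstoLaw.of_log_sub_log hI0 hX0 hXm hlog, TendstoLaw.of_log_sub_log hX0 hI0 hIm hlog'⟩
  refine ⟨hlog.tendstoInDistribution fun N ↦ ?_,
    hrem.tendstoInDistribution fun N ↦ aemeasurable_remainder N, exists_congr hiff, hiff⟩
  exact (Real.measurable_log.comp_aemeasurable (hIm N)).sub
    (Real.measurable_log.comp_aemeasurable (hXm N))
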